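/- Let $f:\mathbb R\to\mathbb R$ be infinitely differentiable at $x_0\neq 0$, put $\gamma_k=\frac{f^{(k)}(x_0)}{k!}x_0^k$, and let $m:\mathbb R\to\mathbb R$ be differentiable at $\theta$. Assume that $f(m(\theta))=\sum_{k\ge 0}\gamma_k\left(\frac{m(\theta)}{x_0}-1\right)^k$, that $|\gamma_k|\le c$ for all $k$ and some $c>0$, that $g^k=o(|\gamma_k|)$ as $k\to\infty$ for every $g\in(0,1)$, and that $\left|\frac{m(\theta)}{x_0}-1\right|<1$. Let $(X_1,G_1),(X_2,G_2),\dots$ be i.i.d. pairs of real random variables with finite second moments, $\mathbb E[X_i]=m(\theta)$ and $\mathbb E[G_i]=\nabla_\theta m(\theta)=m'(\theta)$, and assume $$\beta^2:=\frac{\operatorname{var}(X_1)}{x_0^2}+\left(\frac{m(\theta)}{x_0}-1\right)^2<1.$$ For $p\in(0,1-\beta^2)$ let $R=R_p$ be independent of the sequence of pairs with $\mathbb P(R=k)=(1-p)^kp$, $k=0,1,\dots$. For $1\le k\le r$ let $$W^{\mathrm S}_{r,k}=G_k\prod_{i=1}^{k-1}\left(\frac{X_i}{x_0}-1\right),\qquad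 W^{\mathrm C}_{r,k}=\frac1r\sum_{j=0}^{r-1}G_{[k+j]}\prod_{i=1}^{k-1}\left(\frac{X_{[i+j]}}{x_0}-1\right),$$ where $[n]\in\{1,\dots,r\}$ is congruent to $n$ modulo $r$, and for $*\in\{\mathrm S,\mathrm C\}$ define the simple ($\mathrm S$) and the cycling ($\mathrm C$) gradient estimator by $$\widehat{\nabla_\theta f}^{*}=\sum_{k=1}^{\infty}\frac{\mathbf 1\{R\ge k\}}{\mathbb P(R\ge k)}\,W^{*}_{R,k}\,\frac{k\gamma_k}{x_0}.$$ Then $\widehat{\nabla_\theta f}^{\mathrm S}$ and $\widehat{\nabla_\theta f}^{\mathrm C}$ are in $\mathcal L_2$ for every $p\in(0,1-\beta^2)$. In addition, as $p\to0^+$: 1. $\operatorname{var}\left(\mathbb E[\widehat{\nabla_\theta f}^{*}\mid R]\right)=\mathcal O(p)$ for $*=\mathrm S$ and for $*=\mathrm C$. 2. $\mathbb E\left[\operatorname{var}(\widehat{\nabla_\theta f}^{\mathrm S}\mid R)\right]$ converges to a finite limit, and this limit can be non-zero: there are data satisfying all of the assumptions above, with $f=\log$ and $x_0>0$, for which it is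 non-zero. 3. $\mathbb E\left[\operatorname{var}(\widehat{\nabla_\theta f}^{\mathrm C}\mid R)\right]=\mathcal O\left(p\log(1/p)\right)$. -/

import Mathlib

open MeasureTheory ProbabilityTheory Filter Topology Asymptotics
open scoped Nat

noncomputable section

/-- The rescaled Taylor coefficient `γ_k = f⁽ᵏ⁾(x₀) / k! * x₀ᵏ`. -/
def taylorCoeff (f : ℝ → ℝ) (x₀ : ℝ) (k : ℕ) : ℝ :=
  iteratedDeriv k f x₀ / (k ! : ℝ) * x₀ ^ k

/-- The standing assumption on the function `f`, the argument `m` and the expansion point `x₀`: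
the Taylor series of `f` at `x₀` converges to `f` at `m`, the coefficients `γ_k` are bounded and
decay slower than any geometric sequence, and `|m / x₀ - 1| < 1`. -/
structure TaylorAssumption (f : ℝ → ℝ) (m x₀ : ℝ) : Prop where
  smooth : ContDiffAt ℝ ((⊤ : ℕ∞) : WithTop ℕ∞) f x₀
  hasSum : HasSum (fun k : ℕ => taylorCoeff f x₀ k * (m / x₀ - 1) ^ k) (f m)
  bounded : ∃ c : ℝ, 0 < c ∧ ∀ k : ℕ, |taylorCoeff f x₀ k| ≤ c
  slow : ∀ g : ℝ, 0 < g → g < 1 →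
    (fun k : ℕ => g ^ k) =o[atTop] (fun k : ℕ => |taylorCoeff f x₀ k|)
  beta_zero_lt_one : |m / x₀ - 1| < 1

section Estimators

variable {Ω : Type*}

/-- The simple estimate `W_{r,k} = G_k ∏_{i=1}^{k-1} (X_i / x₀ - 1)`, `1 ≤ k ≤ r`, of
`(m / x₀ - 1)^(k-1) ∇m`. The samples are indexed from `0`, that is, `X i` and `G i` stand for
`X_{i+1}` and `G_{i+1}`. It does not depend on `r`. -/
def simpleW (x₀ : ℝ) (X G : ℕ → Ω → ℝ) (_r k : ℕ) (ω : Ω) : ℝ :=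
  G (k - 1) ω * ∏ i ∈ Finset.range (k - 1), (X i ω / x₀ - 1)

/-- The cycling estimate: the average of the simple estimates over the `r` circular shifts of the
first `r` samples. -/
def cyclingW (x₀ : ℝ) (X G : ℕ → Ω → ℝ) (r k : ℕ) (ω : Ω) : ℝ :=
  (1 / (r : ℝ)) * ∑ j ∈ Finset.range r,
    simpleW x₀ (fun i => X ((i + j) % r)) (fun i => G ((i + j) % r)) r k ω

/-- The gradient sum estimator
`∑_{k ≥ 1} 1{R ≥ k} / P(R ≥ k) * W_{R,k} * (k γ_k / x₀)`. -/
def gradSumEst [MeasurableSpace Ω] (μ : Measure Ω) (f : ℝ → ℝ) (x₀ : ℝ) (R : Ω → ℕ)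
    (W : ℕ → ℕ → Ω → ℝ) (ω : Ω) : ℝ :=
  ∑ k ∈ Finset.Icc 1 (R ω),
    1 / μ.real {ω' | k ≤ R ω'} * W (R ω) k ω * (k * taylorCoeff f x₀ k / x₀)

/-- `var(E[F | R])`. -/
def varCondExp [MeasurableSpace Ω] (μ : Measure Ω) (R : Ω → ℕ) (F : Ω → ℝ) : ℝ :=
  variance (μ[F | MeasurableSpace.comap R ⊤]) μ

/-- `E[var(F | R)]`. -/
def expCondVar [MeasurableSpace Ω] (μ : Measure Ω) (R : Ω → ℕ) (F : Ω → ℝ) : ℝ :=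
  ∫ ω, condVar (MeasurableSpace.comap R ⊤) F μ ω ∂μ

/-- `β² = var(X₁) / x₀² + (m / x₀ - 1)²`. -/
def betaSq [MeasurableSpace Ω] (μ : Measure Ω) (x₀ m : ℝ) (X : ℕ → Ω → ℝ) : ℝ :=
  variance (X 0) μ / x₀ ^ 2 + (m / x₀ - 1) ^ 2

/-- The setting: `(X_i, G_i)` are i.i.d. pairs with finite second moments, with
`E[X_i] = m(θ)` and `E[G_i] = m'(θ)`; the Taylor assumption holds at `m(θ)`; `β² < 1`; and for each
`p ∈ (0, 1 - β²)`, `R p` is geometric, `P(R p = k) = (1 - p)^k p` for `k = 0, 1, …`, and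
independent of the pairs. -/
structure GradientSetting [MeasurableSpace Ω] (μ : Measure Ω) (f : ℝ → ℝ) (x₀ : ℝ)
    (m : ℝ → ℝ) (θ : ℝ) (X G : ℕ → Ω → ℝ) (R : ℝ → Ω → ℕ) : Prop where
  x₀_ne_zero : x₀ ≠ 0
  measurable_X : ∀ i, Measurable (X i)
  measurable_G : ∀ i, Measurable (G i)
  indep : iIndepFun (fun i ω => (X i ω, G i ω)) μ
  identDistrib : ∀ i, IdentDistrib (fun ω => (X i ω, G i ω)) (fun ω => (X 0 ω, G 0 ω)) μ μ
  memLp_X : MemLp (X 0) 2 μ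
  memLp_G : MemLp (G 0) 2 μ
  mean_X : ∫ ω, X 0 ω ∂μ = m θ
  mean_G : HasDerivAt m (∫ ω, G 0 ω ∂μ) θ
  taylor : TaylorAssumption f (m θ) x₀
  betaSq_lt_one : betaSq μ x₀ (m θ) X < 1
  measurable_R : ∀ p : ℝ, 0 < p → p < 1 - betaSq μ x₀ (m θ) X → Measurable (R p)
  law_R : ∀ (p : ℝ) (hp₀ : 0 < p) (hp₁ : p ≤ 1), p < 1 - betaSq μ x₀ (m θ) X →
    HasLaw (R p) (geometricMeasure ⟨p, hp₀.le, hp₁⟩) μ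
  indep_R : ∀ p : ℝ, 0 < p → p < 1 - betaSq μ x₀ (m θ) X →
    IndepFun (R p) (fun ω (i : ℕ) => (X i ω, G i ω)) μ

end Estimators

end

/-! Since `R` is independent of the pairs, conditioning on `R = r` amounts to freezing `r`. The
estimator becomes a finite sum over `1 ≤ k ≤ r` with weights `q ^ (-k)`, `q = 1 - p`, and each claim
becomes a statement about a series with weights `q ^ r * p`. The L² norm of the `k`-th summand is at
most a constant times `k * q ^ (-k) * β ^ (k - 1)`. For a fixed `p < 1 - β²`, Cauchy–Schwarz over
the `r` summands and `max q (β² / q) < 1` give square integrability. As `p → 0`, `q` stays away from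
`β`, so these norms, even multiplied by another `k`, are at most `K * ρ ^ k` with `K` and `ρ < 1`
independent of `p` (`exists_geometric_bound`). The three asymptotic claims follow from this bound.
Conditional mean: given `R = r` it is a partial sum of a geometrically dominated series, so it
differs from the full sum by `O(ρ ^ r)`. As `P(R = r) ≤ p`, the second moment of the difference is
`O(p)`. Simple estimator: by dominated convergence the variance of the frozen sum converges, as `r →
∞` and `p → 0` jointly, to a double series of covariances. The geometric mass escapes to infinity,
so the average over `r` has the same limit (`tendsto_geometric_average`). Cycling estimator: shifts
that use disjoint sets of samples are uncorrelated, and a given shift meets at most `k²` others, so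
averaging reduces the variance to `O(k² β^(2(k-1)) / r)` (`variance_cyclingW_le`). The frozen sum
then has variance `O(1 / r)`, and `∑ q ^ r * p / r = p log (1 / p)`. Non-zero limit: for the
logarithm expanded at the mean of Gaussian samples, with unit gradient samples, the summands are
uncorrelated. The double series reduces to its nonnegative diagonal, whose entry at `k = 2` is
positive. -/

/-! ### Conditioning on an independent geometric variable -/

section Freezing

variable {Ω E : Type*} [MeasurableSpace Ω] [MeasurableSpace E] {μ : Measure Ω}
  [IsProbabilityMeasure μ] {R : Ω → ℕ} {Z : Ω → E} {u : ℕ → E → ℝ} {p : unitInterval}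

/-- Independence makes the joint law of `R` and `Z` a product, so Fubini integrates out `Z` first;
the remaining integral over the geometric law is a series. -/
theorem hasSum_integral_of_indepFun_geometric (hp : p ≠ 0) (hR : Measurable R)
    (hlaw : HasLaw R (geometricMeasure p) μ) (hZ : Measurable Z) (hind : IndepFun R Z μ)
    (hu : ∀ r, Measurable (u r)) (hint : Integrable (fun ω => u (R ω) (Z ω)) μ) :
    HasSum (fun r => ((1 - p : ℝ) ^ r * p) * ∫ ω, u r (Z ω) ∂μ) (∫ ω, u (R ω) (Z ω) ∂μ) := by
  have hm : Measurable (Function.uncurry u) := measurable_from_prod_countable_right hu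
  have hmap := (indepFun_iff_map_prod_eq_prod_map_map hR.aemeasurable hZ.aemeasurable).1 hind
  have hint' : Integrable (Function.uncurry u) ((μ.map R).prod (μ.map Z)) := by
    rw [← hmap, integrable_map_measure hm.aestronglyMeasurable (hR.prodMk hZ).aemeasurable]
    exact hint
  rw [hlaw.map_eq] at hint'
  have h1 : ∫ ω, u (R ω) (Z ω) ∂μ = ∫ r, ∫ z, u r z ∂(μ.map Z) ∂(geometricMeasure p) := by
    rw [← hlaw.map_eq, integral_integral (f := u) (by rw [hlaw.map_eq]; exact hint'), ← hmap,
      integral_map (hR.prodMk hZ).aemeasurable]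
    exact hm.aestronglyMeasurable
  have h2 := hasSum_integral_geometricMeasure hp hint'.integral_prod_left
  rw [h1]
  refine h2.congr_fun fun r => ?_
  rw [smul_eq_mul]
  congr 1
  exact (integral_map hZ.aemeasurable (hu r).aestronglyMeasurable).symm

theorem integrable_of_indepFun_geometric (hp : p ≠ 0) (hR : Measurable R)
    (hlaw : HasLaw R (geometricMeasure p) μ) (hZ : Measurable Z) (hind : IndepFun R Z μ)
    (hu : ∀ r, Measurable (u r)) (hint : ∀ r, Integrable (fun ω => u r (Z ω)) μ)
    (hsum : Summable (fun r => ((1 - p : ℝ) ^ r * p) * ∫ ω, ‖u r (Z ω)‖ ∂μ)) :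
    Integrable (fun ω => u (R ω) (Z ω)) μ := by
  have hm : Measurable (Function.uncurry u) := measurable_from_prod_countable_right hu
  have hmap := (indepFun_iff_map_prod_eq_prod_map_map hR.aemeasurable hZ.aemeasurable).1 hind
  suffices Integrable (Function.uncurry u) (μ.map fun ω => (R ω, Z ω)) from
    (integrable_map_measure hm.aestronglyMeasurable (hR.prodMk hZ).aemeasurable).1 this
  rw [hmap, hlaw.map_eq, integrable_prod_iff hm.aestronglyMeasurable]
  have h1 (r : ℕ) : Integrable (u r) (μ.map Z) :=
    (integrable_map_measure (hu r).aestronglyMeasurable hZ.aemeasurable).2 (hint r)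
  refine ⟨ae_of_all _ h1, (integrable_geometricMeasure_iff hp).2 ?_⟩
  convert hsum using 3 with r
  rw [Real.norm_of_nonneg (integral_nonneg fun _ => norm_nonneg _)]
  exact integral_map hZ.aemeasurable (hu r).norm.aestronglyMeasurable

theorem memLp_two_of_indepFun_geometric (hp : p ≠ 0) (hR : Measurable R)
    (hlaw : HasLaw R (geometricMeasure p) μ) (hZ : Measurable Z) (hind : IndepFun R Z μ)
    (hu : ∀ r, Measurable (u r)) (hint : ∀ r, MemLp (fun ω => u r (Z ω)) 2 μ)
    (hsum : Summable (fun r => ((1 - p : ℝ) ^ r * p) * ∫ ω, u r (Z ω) ^ 2 ∂μ)) :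
    MemLp (fun ω => u (R ω) (Z ω)) 2 μ := by
  have hm : Measurable (fun ω => u (R ω) (Z ω)) :=
    (measurable_from_prod_countable_right (f := Function.uncurry u) hu).comp (hR.prodMk hZ)
  refine (memLp_two_iff_integrable_sq hm.aestronglyMeasurable).2 ?_
  refine integrable_of_indepFun_geometric (u := fun r z => u r z ^ 2) hp hR hlaw hZ hind
    (fun r => (hu r).pow_const 2) (fun r => (hint r).integrable_sq) ?_
  simpa using hsum

/-- By independence the conditional law of `Z` given `R` is the constant kernel with value the law
of `Z`. -/
theorem condExp_comap_ae_eq_integral [StandardBorelSpace E] [Nonempty E] (hR : Measurable R)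
    (hZ : Measurable Z) (hind : IndepFun R Z μ)
    (hu : ∀ r, Measurable (u r)) (hint : Integrable (fun ω => u (R ω) (Z ω)) μ) :
    μ[fun ω => u (R ω) (Z ω) | MeasurableSpace.comap R ⊤] =ᵐ[μ]
      fun ω => ∫ ω', u (R ω) (Z ω') ∂μ := by
  have hm : Measurable (Function.uncurry u) := measurable_from_prod_countable_right hu
  have h1 := condExp_prod_ae_eq_integral_condDistrib (f := Function.uncurry u) hR hZ.aemeasurable
    hm.stronglyMeasurable hint
  have hcd : condDistrib Z R μ =ᵐ[μ.map R] Kernel.const ℕ (μ.map Z) := by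
    refine condDistrib_ae_eq_of_measure_eq_compProd R hZ.aemeasurable ?_
    rw [Measure.compProd_const]
    exact (indepFun_iff_map_prod_eq_prod_map_map hR.aemeasurable hZ.aemeasurable).1 hind
  have h2 := ae_of_ae_map hR.aemeasurable hcd
  filter_upwards [h1, h2] with ω h1 h2
  refine h1.trans ?_
  rw [h2, Kernel.const_apply]
  exact integral_map hZ.aemeasurable (hu _).aestronglyMeasurable

theorem hasSum_expCondVar [StandardBorelSpace E] [Nonempty E] (hp : p ≠ 0) (hR : Measurable R)
    (hlaw : HasLaw R (geometricMeasure p) μ) (hZ : Measurable Z) (hind : IndepFun R Z μ)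
    (hu : ∀ r, Measurable (u r)) (hF : MemLp (fun ω => u (R ω) (Z ω)) 2 μ) :
    HasSum (fun r => ((1 - p : ℝ) ^ r * p) * variance (fun ω => u r (Z ω)) μ)
      (expCondVar μ R (fun ω => u (R ω) (Z ω))) := by
  have hce := condExp_comap_ae_eq_integral hR hZ hind hu (hF.integrable one_le_two)
  have hle : MeasurableSpace.comap R ⊤ ≤ ‹MeasurableSpace Ω› := hR.comap_le
  let v : ℕ → E → ℝ := fun r z => (u r z - ∫ ω', u r (Z ω') ∂μ) ^ 2
  have hv (r) : Measurable (v r) := ((hu r).sub_const _).pow_const 2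
  have heq : (fun ω => u (R ω) (Z ω)) - μ[fun ω => u (R ω) (Z ω) | MeasurableSpace.comap R ⊤]
      =ᵐ[μ] fun ω => u (R ω) (Z ω) - ∫ ω', u (R ω) (Z ω') ∂μ := by
    filter_upwards [hce] with ω h
    simp [h]
  have hL : MemLp ((fun ω => u (R ω) (Z ω)) -
      μ[fun ω => u (R ω) (Z ω) | MeasurableSpace.comap R ⊤]) 2 μ := hF.sub (hF.condExp one_le_two)
  have hval : expCondVar μ R (fun ω => u (R ω) (Z ω)) = ∫ ω, v (R ω) (Z ω) ∂μ := by
    unfold expCondVar condVar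
    rw [integral_condExp hle]
    refine integral_congr_ae ?_
    filter_upwards [heq] with ω h
    simp only [Pi.pow_apply, h, v]
  have hint : Integrable (fun ω => v (R ω) (Z ω)) μ := by
    refine hL.integrable_sq.congr ?_
    filter_upwards [heq] with ω h
    simp only [h, v]
  rw [hval]
  convert hasSum_integral_of_indepFun_geometric hp hR hlaw hZ hind hv hint using 3 with r
  exact variance_eq_integral ((hu r).comp hZ).aemeasurable

/-- The variance is at most the second moment about any constant `c`. Bounding every weight `(1 - p)
^ r * p` by `p` leaves a geometric series in `ρ ^ 2`. -/
theorem varCondExp_le_of_abs_sub_le [StandardBorelSpace E] [Nonempty E] (hp : p ≠ 0)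
    (hR : Measurable R)
    (hlaw : HasLaw R (geometricMeasure p) μ) (hZ : Measurable Z) (hind : IndepFun R Z μ)
    (hu : ∀ r, Measurable (u r)) (hF : MemLp (fun ω => u (R ω) (Z ω)) 2 μ)
    {c K ρ : ℝ} (hρ₀ : 0 ≤ ρ) (hρ₁ : ρ < 1)
    (hK : ∀ r, |∫ ω, u r (Z ω) ∂μ - c| ≤ K * ρ ^ r) :
    varCondExp μ R (fun ω => u (R ω) (Z ω)) ≤ K ^ 2 / (1 - ρ ^ 2) * p := by
  have hce := condExp_comap_ae_eq_integral hR hZ hind hu (hF.integrable one_le_two)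
  let e : ℕ → ℝ := fun r => ∫ ω, u r (Z ω) ∂μ
  have hsq : ∀ r, (e r - c) ^ 2 ≤ K ^ 2 * (ρ ^ 2) ^ r := fun r => by
    rw [← sq_abs, ← pow_mul, mul_comm 2 r, pow_mul, ← mul_pow]
    exact pow_le_pow_left₀ (abs_nonneg _) (hK r) 2
  have hρ2 : ρ ^ 2 < 1 := by nlinarith
  have hq0 : (0 : ℝ) ≤ 1 - p := sub_nonneg.2 p.2.2
  have hq1 : (1 : ℝ) - p ≤ 1 := sub_le_self _ p.2.1
  have hgeo : HasSum (fun r : ℕ => K ^ 2 * (p : ℝ) * (ρ ^ 2) ^ r) (K ^ 2 * p * (1 - ρ ^ 2)⁻¹) :=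
    (hasSum_geometric_of_lt_one (sq_nonneg ρ) hρ2).mul_left _
  have hterm (r : ℕ) : ((1 - p : ℝ) ^ r * p) * (e r - c) ^ 2 ≤ K ^ 2 * (p : ℝ) * (ρ ^ 2) ^ r := by
    calc ((1 - p : ℝ) ^ r * p) * (e r - c) ^ 2 ≤ (1 * p) * (K ^ 2 * (ρ ^ 2) ^ r) := by
          have := p.2.1
          gcongr
          · exact pow_le_one₀ hq0 hq1
          · exact hsq r
      _ = _ := by ring
  have hint : Integrable (fun r => (e r - c) ^ 2) (geometricMeasure p) := by
    refine (integrable_geometricMeasure_iff hp).2 (Summable.of_nonneg_of_le (fun r => ?_)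
      (fun r => ?_) hgeo.summable)
    · exact mul_nonneg (geometricMeasure_nonneg p r) (norm_nonneg _)
    · rw [Real.norm_of_nonneg (sq_nonneg _)]; exact hterm r
  have hem : Measurable e := measurable_of_countable _
  calc varCondExp μ R (fun ω => u (R ω) (Z ω)) = variance (fun ω => e (R ω)) μ :=
        variance_congr hce
    _ = variance (fun ω => e (R ω) - c) μ :=
        (variance_sub_const (hem.comp hR).aestronglyMeasurable c).symm
    _ ≤ ∫ ω, (e (R ω) - c) ^ 2 ∂μ :=
        variance_le_expectation_sq (X := fun ω => e (R ω) - c)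
          ((hem.comp hR).sub_const c).aestronglyMeasurable
    _ = ∫ r, (e r - c) ^ 2 ∂(geometricMeasure p) :=
        hlaw.integral_comp (f := fun r => (e r - c) ^ 2)
          (measurable_of_countable _).aestronglyMeasurable
    _ ≤ K ^ 2 * p * (1 - ρ ^ 2)⁻¹ :=
        hasSum_le hterm (hasSum_integral_geometricMeasure hp hint) hgeo
    _ = _ := by rw [div_eq_mul_inv]; ring

omit [IsProbabilityMeasure μ] in
theorem measureReal_ge_geometric (hp : p ≠ 0)
    (hlaw : HasLaw R (geometricMeasure p) μ) (k : ℕ) :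
    μ.real {ω | k ≤ R ω} = (1 - p : ℝ) ^ k := by
  have h0 : μ.real {ω | k ≤ R ω} = (geometricMeasure p).real {n | k ≤ n} :=
    hlaw.measureReal_eq (p := fun n => k ≤ n) .of_discrete
  have h1 : (geometricMeasure p).real {n | k ≤ n} =
      ∫ n, Set.indicator {n | k ≤ n} (fun _ => (1 : ℝ)) n ∂(geometricMeasure p) := by
    rw [integral_indicator .of_discrete]; simp
  rw [h0, h1]
  have h2 := hasSum_integral_geometricMeasure (f := Set.indicator {n | k ≤ n} (fun _ => (1 : ℝ))) hp
    ((integrable_const 1).indicator .of_discrete)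
  have hq : (1 - p : ℝ) < 1 := sub_lt_self _ (unitInterval.pos_iff_ne_zero.2 hp)
  have hp' : (p : ℝ) ≠ 0 := by simpa using hp
  have h3 : HasSum (fun n : ℕ => (1 - p : ℝ) ^ k * p * (1 - p : ℝ) ^ n) ((1 - p : ℝ) ^ k) := by
    have h := (hasSum_geometric_of_lt_one (sub_nonneg.2 p.2.2) hq).mul_left ((1 - p : ℝ) ^ k * p)
    rwa [sub_sub_cancel, mul_assoc, mul_inv_cancel₀ hp', mul_one] at h
  refine h2.unique ?_
  -- The indicator kills the first `k` terms; the shifted series is geometric.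
  rw [← hasSum_nat_add_iff' k, Finset.sum_eq_zero, sub_zero]
  · refine h3.congr_fun fun n => ?_
    simp [pow_add]; ring
  · intro i hi
    simp [Finset.mem_range.1 hi]

end Freezing

/-! ### Moments of products and covariance inequalities -/

section Moments

variable {Ω : Type*} [MeasurableSpace Ω] {μ : Measure Ω}

theorem iIndepFun_integrable_prod_and_integral [IsProbabilityMeasure μ] {K : ℕ → Ω → ℝ}
    (hind : iIndepFun K μ) (hm : ∀ i, Measurable (K i)) (s : Finset ℕ)
    (hK : ∀ i ∈ s, Integrable (K i) μ) :
    Integrable (fun ω => ∏ i ∈ s, K i ω) μ ∧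
      ∫ ω, ∏ i ∈ s, K i ω ∂μ = ∏ i ∈ s, ∫ ω, K i ω ∂μ := by
  induction s using Finset.induction_on with
  | empty => simp
  | insert t s ht ih =>
    obtain ⟨h1, h2⟩ := ih fun i hi => hK i (Finset.mem_insert_of_mem hi)
    have ht' := hK t (Finset.mem_insert_self t s)
    have hi : IndepFun (K t) (fun ω => ∏ i ∈ s, K i ω) μ := by
      have := (hind.indepFun_finsetProd_of_notMem hm ht).symm
      convert this using 1
      ext ω
      simp
    simp only [Finset.prod_insert ht]
    refine ⟨hi.integrable_mul ht' h1, ?_⟩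
    rw [hi.integral_fun_mul_eq_mul_integral ht'.aestronglyMeasurable h1.aestronglyMeasurable, h2]

/-- The variance of `l * X + Y` is a nonnegative quadratic polynomial in `l`, so its discriminant is
not positive. -/
theorem sq_covariance_le [IsProbabilityMeasure μ] {X Y : Ω → ℝ} (hX : MemLp X 2 μ)
    (hY : MemLp Y 2 μ) : (covariance X Y μ) ^ 2 ≤ variance X μ * variance Y μ := by
  have h (l : ℝ) : 0 ≤ variance X μ * (l * l) + 2 * covariance X Y μ * l + variance Y μ := by
    have h1 := variance_nonneg (fun ω => l * X ω + Y ω) μ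
    rw [variance_fun_add (hX.const_mul l) hY, variance_const_mul, covariance_const_mul_left] at h1
    linarith
  have := discrim_le_zero h
  unfold discrim at this
  linarith

theorem abs_covariance_le [IsProbabilityMeasure μ] {X Y : Ω → ℝ} (hX : MemLp X 2 μ)
    (hY : MemLp Y 2 μ) {s t : ℝ} (hs : 0 ≤ s) (ht : 0 ≤ t) (hXs : variance X μ ≤ s ^ 2)
    (hYt : variance Y μ ≤ t ^ 2) : |covariance X Y μ| ≤ s * t := by
  refine abs_le_of_sq_le_sq ?_ (mul_nonneg hs ht)
  calc _ ≤ variance X μ * variance Y μ := sq_covariance_le hX hY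
    _ ≤ s ^ 2 * t ^ 2 := mul_le_mul hXs hYt (variance_nonneg _ _) (sq_nonneg _)
    _ = _ := by ring

/-- Minkowski's inequality for standard deviations: every covariance is bounded by `t i * t j`. -/
theorem variance_sum_le_sq_sum [IsProbabilityMeasure μ] {ι : Type*} {W : ι → Ω → ℝ}
    {s : Finset ι} {t : ι → ℝ} (hW : ∀ i ∈ s, MemLp (W i) 2 μ) (ht : ∀ i ∈ s, 0 ≤ t i)
    (hv : ∀ i ∈ s, variance (W i) μ ≤ t i ^ 2) :
    variance (fun ω => ∑ i ∈ s, W i ω) μ ≤ (∑ i ∈ s, t i) ^ 2 := by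
  rw [variance_fun_sum' hW, sq, Finset.sum_mul_sum]
  exact Finset.sum_le_sum fun i hi => Finset.sum_le_sum fun j hj => (le_abs_self _).trans <|
    abs_covariance_le (hW i hi) (hW j hj) (ht i hi) (ht j hj) (hv i hi) (hv j hj)

variable {U V : ℕ → Ω → ℝ}

/-- Choosing one coordinate of each pair keeps independence across indices. This turns `U t * ∏ V i`
into a product of a single independent family, although `U i` and `V i` may be dependent. -/
theorem iIndepFun_ite (hind : iIndepFun (fun i ω => (U i ω, V i ω)) μ) (t : ℕ) :
    iIndepFun (fun i ω => if i = t then U i ω else V i ω) μ := by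
  have := hind.comp (fun i z => if i = t then z.1 else z.2) (fun i => by
    by_cases h : i = t <;> simp only [h, if_true, if_false] <;> fun_prop)
  exact this

theorem integrable_mul_prod_and_integral [IsProbabilityMeasure μ]
    (hind : iIndepFun (fun i ω => (U i ω, V i ω)) μ)
    (hU : ∀ i, Measurable (U i)) (hV : ∀ i, Measurable (V i))
    (hUi : ∀ i, Integrable (U i) μ) (hVi : ∀ i, Integrable (V i) μ) {t : ℕ} {s : Finset ℕ}
    (ht : t ∉ s) :
    Integrable (fun ω => U t ω * ∏ i ∈ s, V i ω) μ ∧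
      ∫ ω, U t ω * ∏ i ∈ s, V i ω ∂μ = (∫ ω, U t ω ∂μ) * ∏ i ∈ s, ∫ ω, V i ω ∂μ := by
  have h := iIndepFun_integrable_prod_and_integral (iIndepFun_ite hind t) (fun i => by
    by_cases h : i = t <;> simp only [h, if_true, if_false] <;> apply_assumption)
    (insert t s) (fun i _ => by
    by_cases h : i = t <;> simp only [h, if_true, if_false] <;> apply_assumption)
  simp only [Finset.prod_insert ht, if_true] at h
  have hne : ∀ i ∈ s, i ≠ t := fun i hi hit => ht (hit ▸ hi)
  have e1 (ω : Ω) : ∏ i ∈ s, (if i = t then U i ω else V i ω) = ∏ i ∈ s, V i ω :=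
    Finset.prod_congr rfl fun i hi => if_neg (hne i hi)
  have e2 : ∏ i ∈ s, ∫ ω, (if i = t then U i ω else V i ω) ∂μ = ∏ i ∈ s, ∫ ω, V i ω ∂μ :=
    Finset.prod_congr rfl fun i hi => by simp [hne i hi]
  simpa only [e1, e2] using h

theorem indepFun_mul_prod_of_disjoint [IsProbabilityMeasure μ]
    (hind : iIndepFun (fun i ω => (U i ω, V i ω)) μ)
    (hU : ∀ i, Measurable (U i)) (hV : ∀ i, Measurable (V i)) {t t' : ℕ} {s s' : Finset ℕ}
    (h : Disjoint (insert t s) (insert t' s')) :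
    IndepFun (fun ω => U t ω * ∏ i ∈ s, V i ω) (fun ω => U t' ω * ∏ i ∈ s', V i ω) μ := by
  have key (t : ℕ) (s : Finset ℕ) : ∃ f : (↥(insert t s) → ℝ × ℝ) → ℝ, Measurable f ∧
      (fun ω => U t ω * ∏ i ∈ s, V i ω) =
        f ∘ (fun ω (i : ↥(insert t s)) => (U i ω, V i ω)) := by
    refine ⟨fun z => (z ⟨t, Finset.mem_insert_self t s⟩).1 *
      ∏ i : s, (z ⟨i, Finset.mem_insert_of_mem i.2⟩).2, by fun_prop, ?_⟩
    ext ω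
    simp only [Function.comp]
    rw [Finset.prod_coe_sort s (fun i => V i ω)]
  obtain ⟨f, hf, hf'⟩ := key t s
  obtain ⟨f', hg, hg'⟩ := key t' s'
  rw [hf', hg']
  exact (hind.indepFun_finset _ _ h fun i => (hU i).prodMk (hV i)).comp hf hg

end Moments

/-! ### Simple estimates along reindexed samples, and their cyclic averages -/

section Windows

theorem simpleW_comp_eq {Ω : Type*} {x₀ : ℝ} {X G : ℕ → Ω → ℝ} {σ : ℕ → ℕ} {k : ℕ} (hσ : Set.InjOn σ (Finset.range k)) (r : ℕ) (ω : Ω) :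
    simpleW x₀ (fun i => X (σ i)) (fun i => G (σ i)) r k ω =
      G (σ (k - 1)) ω * ∏ i ∈ (Finset.range (k - 1)).image σ, (X i ω / x₀ - 1) := by
  rw [simpleW, Finset.prod_image]
  exact hσ.mono (by simp)

variable {Ω : Type*} [MeasurableSpace Ω] {μ : Measure Ω}
  {f : ℝ → ℝ} {x₀ : ℝ} {m : ℝ → ℝ} {θ : ℝ} {X G : ℕ → Ω → ℝ} {R : ℝ → Ω → ℕ}

theorem image_range_pred_notMem {σ : ℕ → ℕ} {k : ℕ} (hk : 1 ≤ k)
    (hσ : Set.InjOn σ (Finset.range k)) :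
    σ (k - 1) ∉ (Finset.range (k - 1)).image σ := by
  intro h
  obtain ⟨i, hi, h⟩ := Finset.mem_image.1 h
  have hi' := Finset.mem_range.1 hi
  have := hσ (by simp; omega) (by simp; omega) h
  omega

theorem insert_image_range_pred {σ : ℕ → ℕ} {k : ℕ} (hk : 1 ≤ k) :
    insert (σ (k - 1)) ((Finset.range (k - 1)).image σ) = (Finset.range k).image σ := by
  obtain ⟨k, rfl⟩ := Nat.exists_eq_add_of_le' hk
  simp [Finset.range_add_one, Finset.image_insert]

namespace GradientSetting

variable (h : GradientSetting μ f x₀ m θ X G R)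

include h

theorem measurable_simpleW (σ : ℕ → ℕ) (r k : ℕ) :
    Measurable (simpleW x₀ (fun i => X (σ i)) (fun i => G (σ i)) r k) := by
  have h1 := h.measurable_X
  have h2 := h.measurable_G
  unfold simpleW
  fun_prop

theorem memLp_X' (i : ℕ) : MemLp (X i) 2 μ :=
  ((h.identDistrib i).comp measurable_fst).memLp_iff.2 h.memLp_X

theorem memLp_G' (i : ℕ) : MemLp (G i) 2 μ :=
  ((h.identDistrib i).comp measurable_snd).memLp_iff.2 h.memLp_G

theorem iIndepFun_ratio : iIndepFun (fun i ω => (G i ω, X i ω / x₀ - 1)) μ :=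
  h.indep.comp (fun _ z => (z.2, z.1 / x₀ - 1)) fun _ => by fun_prop

variable [IsProbabilityMeasure μ]

theorem memLp_ratio (i : ℕ) : MemLp (fun ω => X i ω / x₀ - 1) 2 μ := by
  have := ((h.memLp_X' i).mul_const x₀⁻¹).sub (memLp_const 1)
  simp only [div_eq_mul_inv]
  exact this

theorem integral_ratio (i : ℕ) : ∫ ω, (X i ω / x₀ - 1) ∂μ = m θ / x₀ - 1 := by
  have h1 : ∫ ω, X i ω ∂μ = m θ :=
    ((h.identDistrib i).comp measurable_fst).integral_eq.trans h.mean_X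
  rw [integral_sub (((h.memLp_X' i).integrable one_le_two).div_const _) (integrable_const _),
    integral_div, h1]
  simp

theorem integral_ratio_sq (i : ℕ) :
    ∫ ω, (X i ω / x₀ - 1) ^ 2 ∂μ = betaSq μ x₀ (m θ) X := by
  have h1 : variance (X i) μ = variance (X 0) μ :=
    ((h.identDistrib i).comp measurable_fst).variance_eq
  have h2 := variance_eq_sub (h.memLp_ratio i)
  have h3 : variance (fun ω => X i ω / x₀ - 1) μ = variance (X i) μ / x₀ ^ 2 := by
    rw [variance_sub_const ((h.measurable_X i).div_const x₀).aestronglyMeasurable]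
    simp only [div_eq_mul_inv]
    rw [variance_mul_const, inv_pow, mul_comm]
  have h4 := h.integral_ratio i
  rw [h3, h4, h1] at h2
  simp only [Pi.pow_apply] at h2
  rw [betaSq]
  linarith

theorem betaSq_nonneg : 0 ≤ betaSq μ x₀ (m θ) X := by
  rw [← h.integral_ratio_sq 0]
  positivity

/-- An injective `σ` selects `k` distinct samples, so the expectation factorizes. The second moment
is the same computation for the squared pairs. -/
theorem memLp_and_integral_simpleW_comp {σ : ℕ → ℕ} {k : ℕ} (hk : 1 ≤ k)
    (hσ : Set.InjOn σ (Finset.range k)) (r : ℕ) :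
    MemLp (simpleW x₀ (fun i => X (σ i)) (fun i => G (σ i)) r k) 2 μ ∧
    ∫ ω, simpleW x₀ (fun i => X (σ i)) (fun i => G (σ i)) r k ω ∂μ =
      (∫ ω, G 0 ω ∂μ) * (m θ / x₀ - 1) ^ (k - 1) ∧
    ∫ ω, simpleW x₀ (fun i => X (σ i)) (fun i => G (σ i)) r k ω ^ 2 ∂μ =
      (∫ ω, G 0 ω ^ 2 ∂μ) * betaSq μ x₀ (m θ) X ^ (k - 1) := by
  have hs := image_range_pred_notMem hk hσ
  have hcard : ((Finset.range (k - 1)).image σ).card = k - 1 := by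
    rw [Finset.card_image_of_injOn (hσ.mono (by simp)), Finset.card_range]
  have hX := h.measurable_X
  have hYm (i : ℕ) : Measurable (fun ω => X i ω / x₀ - 1) := by fun_prop
  have h1 := integrable_mul_prod_and_integral h.iIndepFun_ratio h.measurable_G hYm
    (fun i => (h.memLp_G' i).integrable one_le_two)
    (fun i => (h.memLp_ratio i).integrable one_le_two) hs
  have h2 := integrable_mul_prod_and_integral (U := fun i ω => G i ω ^ 2)
    (V := fun i ω => (X i ω / x₀ - 1) ^ 2)
    (h.iIndepFun_ratio.comp (fun _ z => (z.1 ^ 2, z.2 ^ 2)) fun _ => by fun_prop)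
    (fun i => (h.measurable_G i).pow_const 2) (fun i => (hYm i).pow_const 2)
    (fun i => (h.memLp_G' i).integrable_sq) (fun i => (h.memLp_ratio i).integrable_sq) hs
  have e1 : ∫ ω, G (σ (k - 1)) ω ∂μ = ∫ ω, G 0 ω ∂μ :=
    ((h.identDistrib _).comp measurable_snd).integral_eq
  have e2 : ∫ ω, G (σ (k - 1)) ω ^ 2 ∂μ = ∫ ω, G 0 ω ^ 2 ∂μ :=
    ((h.identDistrib _).comp (u := fun z : ℝ × ℝ => z.2 ^ 2) (by fun_prop)).integral_eq
  simp only [h.integral_ratio, h.integral_ratio_sq, Finset.prod_const, hcard, Finset.prod_pow,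
    ← mul_pow, e1, e2] at h1 h2
  refine ⟨(memLp_two_iff_integrable_sq (h.measurable_simpleW σ r k).aestronglyMeasurable).2 ?_,
    ?_, ?_⟩
  · simp only [simpleW_comp_eq hσ]
    exact h2.1
  · simp only [simpleW_comp_eq hσ]
    exact h1.2
  · simp only [simpleW_comp_eq hσ]
    exact h2.2

theorem memLp_and_integral_simpleW {k : ℕ} (hk : 1 ≤ k) (r : ℕ) :
    MemLp (simpleW x₀ X G r k) 2 μ ∧
    ∫ ω, simpleW x₀ X G r k ω ∂μ = (∫ ω, G 0 ω ∂μ) * (m θ / x₀ - 1) ^ (k - 1) ∧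
    ∫ ω, simpleW x₀ X G r k ω ^ 2 ∂μ =
      (∫ ω, G 0 ω ^ 2 ∂μ) * betaSq μ x₀ (m θ) X ^ (k - 1) :=
  h.memLp_and_integral_simpleW_comp (σ := id) hk (Set.injOn_id _) r

theorem covariance_simpleW_comp_eq_zero {σ τ : ℕ → ℕ} {k l : ℕ} (hk : 1 ≤ k) (hl : 1 ≤ l)
    (hσ : Set.InjOn σ (Finset.range k)) (hτ : Set.InjOn τ (Finset.range l)) (r : ℕ)
    (hd : Disjoint ((Finset.range k).image σ) ((Finset.range l).image τ)) :
    covariance (simpleW x₀ (fun i => X (σ i)) (fun i => G (σ i)) r k)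
      (simpleW x₀ (fun i => X (τ i)) (fun i => G (τ i)) r l) μ = 0 := by
  have hX := h.measurable_X
  refine IndepFun.covariance_eq_zero ?_ (h.memLp_and_integral_simpleW_comp hk hσ r).1
    (h.memLp_and_integral_simpleW_comp hl hτ r).1
  rw [← insert_image_range_pred hk, ← insert_image_range_pred hl] at hd
  have := indepFun_mul_prod_of_disjoint h.iIndepFun_ratio h.measurable_G (fun i => by fun_prop) hd
  rwa [← funext (simpleW_comp_eq hσ r), ← funext (simpleW_comp_eq hτ r)] at this

end GradientSetting

theorem injOn_add_mod {j r k : ℕ} (hkr : k ≤ r) :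
    Set.InjOn (fun i => (i + j) % r) (Finset.range k) := by
  intro a ha b hb hab
  simp only [Finset.coe_range, Set.mem_Iio] at ha hb
  have : a ≡ b [MOD r] := Nat.ModEq.add_right_cancel' j hab
  rwa [Nat.ModEq, Nat.mod_eq_of_lt (ha.trans_le hkr), Nat.mod_eq_of_lt (hb.trans_le hkr)] at this

/-- If the windows of `j` and `j'` meet, then `a + j ≡ b + j'` modulo `r` for some `a, b < k`, and
the pair `(a, b)` determines `j' < r`. -/
theorem card_filter_not_disjoint_le {r k : ℕ} (hkr : k ≤ r) (j : ℕ) :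
    ((Finset.range r).filter fun j' =>
      ¬ Disjoint ((Finset.range k).image fun i => (i + j) % r)
        ((Finset.range k).image fun i => (i + j') % r)).card ≤ k ^ 2 := by
  calc _ ≤ ((Finset.range k ×ˢ Finset.range k).image
        -- Adding `r - z.2` is subtraction of `z.2` modulo `r`, without truncation because `z.2 < k
        -- ≤ r`.
        fun z : ℕ × ℕ => (z.1 + j + (r - z.2)) % r).card := by
        refine Finset.card_le_card fun j' hj' => ?_
        obtain ⟨hj, hd⟩ := Finset.mem_filter.1 hj'
        obtain ⟨x, hx, hx'⟩ := Finset.not_disjoint_iff.1 hd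
        obtain ⟨a, ha, rfl⟩ := Finset.mem_image.1 hx
        obtain ⟨b, hb, hab⟩ := Finset.mem_image.1 hx'
        refine Finset.mem_image.2 ⟨(a, b), Finset.mk_mem_product ha hb, ?_⟩
        have hb' := Finset.mem_range.1 hb
        have h1 : b + j' + (r - b) ≡ a + j + (r - b) [MOD r] := Nat.ModEq.add_right (r - b) hab
        have h2 : b + j' + (r - b) = j' + r := by omega
        rw [h2] at h1
        have h3 : j' % r = (a + j + (r - b)) % r := by
          rw [← h1, Nat.add_mod_right]
        rw [← h3, Nat.mod_eq_of_lt (Finset.mem_range.1 hj)]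
    _ ≤ _ := Finset.card_image_le
    _ = k ^ 2 := by simp [sq]

namespace GradientSetting

variable (h : GradientSetting μ f x₀ m θ X G R)

include h

variable [IsProbabilityMeasure μ]

theorem memLp_and_integral_cyclingW {r k : ℕ} (hk : 1 ≤ k) (hkr : k ≤ r) :
    MemLp (cyclingW x₀ X G r k) 2 μ ∧
    ∫ ω, cyclingW x₀ X G r k ω ∂μ = (∫ ω, G 0 ω ∂μ) * (m θ / x₀ - 1) ^ (k - 1) ∧
    ∫ ω, cyclingW x₀ X G r k ω ^ 2 ∂μ ≤
      (∫ ω, G 0 ω ^ 2 ∂μ) * betaSq μ x₀ (m θ) X ^ (k - 1) := by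
  have hr : (r : ℝ) ≠ 0 := by
    have : r ≠ 0 := by omega
    exact_mod_cast this
  have hs (j : ℕ) := h.memLp_and_integral_simpleW_comp hk (injOn_add_mod (j := j) hkr) r
  have hL : MemLp (cyclingW x₀ X G r k) 2 μ :=
    (memLp_finsetSum (Finset.range r) fun j _ => (hs j).1).const_mul (1 / (r : ℝ))
  refine ⟨hL, ?_, ?_⟩
  · simp only [cyclingW]
    rw [integral_const_mul, integral_finsetSum _ fun j _ => (hs j).1.integrable one_le_two]
    simp only [(hs _).2.1, Finset.sum_const, Finset.card_range, nsmul_eq_mul]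
    field_simp
  -- The square of an average is at most the average of the squares.
  · have hle (ω : Ω) : cyclingW x₀ X G r k ω ^ 2 ≤ (1 / (r : ℝ)) * ∑ j ∈ Finset.range r,
        simpleW x₀ (fun i => X ((i + j) % r)) (fun i => G ((i + j) % r)) r k ω ^ 2 := by
      have := sq_sum_le_card_mul_sum_sq (s := Finset.range r) (f := fun j =>
        simpleW x₀ (fun i => X ((i + j) % r)) (fun i => G ((i + j) % r)) r k ω)
      rw [cyclingW, mul_pow]
      calc _ ≤ (1 / (r : ℝ)) ^ 2 * _ := mul_le_mul_of_nonneg_left this (sq_nonneg _)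
        _ = _ := by rw [Finset.card_range]; field_simp
    have hi := (integrable_finsetSum (Finset.range r) fun j _ =>
      (hs j).1.integrable_sq).const_mul (1 / (r : ℝ))
    refine (integral_mono hL.integrable_sq hi hle).trans (le_of_eq ?_)
    rw [integral_const_mul, integral_finsetSum _ fun j _ => (hs j).1.integrable_sq]
    simp only [(hs _).2.2, Finset.sum_const, Finset.card_range, nsmul_eq_mul]
    field_simp

/-- In the double sum of covariances of the `r` shifts, each row has at most `k ^ 2` entries that
can be non-zero, each at most `B`. The prefactor `1 / r ^ 2` leaves `k ^ 2 * B / r`. -/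
theorem variance_cyclingW_le {r k : ℕ} (hk : 1 ≤ k) (hkr : k ≤ r) :
    variance (cyclingW x₀ X G r k) μ ≤
      k ^ 2 * ((∫ ω, G 0 ω ^ 2 ∂μ) * betaSq μ x₀ (m θ) X ^ (k - 1)) / r := by
  have hr : (0 : ℝ) < r := by
    have : 0 < r := by omega
    exact_mod_cast this
  set B := (∫ ω, G 0 ω ^ 2 ∂μ) * betaSq μ x₀ (m θ) X ^ (k - 1)
  have hB : 0 ≤ B := mul_nonneg (integral_nonneg fun _ => sq_nonneg _)
    (pow_nonneg h.betaSq_nonneg _)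
  let S : ℕ → Ω → ℝ := fun j => simpleW x₀ (fun i => X ((i + j) % r)) (fun i => G ((i + j) % r)) r k
  have hs (j : ℕ) := h.memLp_and_integral_simpleW_comp hk (injOn_add_mod (j := j) hkr) r
  have hvar (j : ℕ) : variance (S j) μ ≤ √B ^ 2 := by
    rw [Real.sq_sqrt hB]
    exact (variance_le_expectation_sq (hs j).1.aestronglyMeasurable).trans (hs j).2.2.le
  have hcov (j j' : ℕ) : covariance (S j) (S j') μ ≤
      if ¬ Disjoint ((Finset.range k).image fun i => (i + j) % r)
        ((Finset.range k).image fun i => (i + j') % r) then B else 0 := by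
    split_ifs with hd
    · exact (h.covariance_simpleW_comp_eq_zero hk hk (injOn_add_mod hkr) (injOn_add_mod hkr) r
        hd).le
    · have := abs_covariance_le (hs j).1 (hs j').1 (Real.sqrt_nonneg B) (Real.sqrt_nonneg B)
        (hvar j) (hvar j')
      rw [Real.mul_self_sqrt hB] at this
      exact (le_abs_self _).trans this
  have hsum : variance (fun ω => ∑ j ∈ Finset.range r, S j ω) μ ≤ r * (k ^ 2 * B) := by
    rw [variance_fun_sum' fun j _ => (hs j).1]
    calc _ ≤ ∑ j ∈ Finset.range r, (k ^ 2 * B : ℝ) := Finset.sum_le_sum fun j _ => by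
          refine (Finset.sum_le_sum fun j' _ => hcov j j').trans ?_
          rw [← Finset.sum_filter, Finset.sum_const, nsmul_eq_mul]
          refine mul_le_mul_of_nonneg_right ?_ hB
          exact_mod_cast card_filter_not_disjoint_le hkr j
      _ = _ := by simp
  have : variance (cyclingW x₀ X G r k) μ =
      (1 / (r : ℝ)) ^ 2 * variance (fun ω => ∑ j ∈ Finset.range r, S j ω) μ :=
    variance_const_mul _ _ _
  rw [this]
  calc _ ≤ (1 / (r : ℝ)) ^ 2 * (r * (k ^ 2 * B)) := mul_le_mul_of_nonneg_left hsum (sq_nonneg _)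
    _ = _ := by field_simp

end GradientSetting

end Windows

/-! ### Deterministic series with geometric weights -/

/-- Half of the decay is spent on the polynomial: `x ^ k = √x ^ k * √x ^ k`, and `k ^ 2 * √x ^ k` is
bounded. Hence `ρ = √x`. -/
theorem exists_sq_mul_pow_le_geometric {x : ℝ} (hx₀ : 0 < x) (hx₁ : x < 1) :
    ∃ K ρ : ℝ, 0 ≤ K ∧ 0 < ρ ∧ ρ < 1 ∧ ∀ k : ℕ, (k : ℝ) ^ 2 * x ^ k ≤ K * ρ ^ k := by
  have hs0 : 0 < √x := Real.sqrt_pos.2 hx₀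
  have hs1 : √x < 1 := by rw [Real.sqrt_lt' one_pos]; simpa using hx₁
  have ht := tendsto_pow_const_mul_const_pow_of_lt_one 2 hs0.le hs1
  obtain ⟨K, hK⟩ := ht.bddAbove_range
  have hK' (k : ℕ) : (k : ℝ) ^ 2 * √x ^ k ≤ K := hK ⟨k, rfl⟩
  refine ⟨K, √x, by simpa using hK' 0, hs0, hs1, fun k => ?_⟩
  calc (k : ℝ) ^ 2 * x ^ k = (k : ℝ) ^ 2 * √x ^ k * √x ^ k := by
        rw [mul_assoc, ← mul_pow, Real.mul_self_sqrt hx₀.le]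
    _ ≤ K * √x ^ k := mul_le_mul_of_nonneg_right (hK' k) (by positivity)

/-- Averages with respect to geometric weights of vanishing parameter converge to the limit at
infinity. -/
theorem tendsto_geometric_average {V : ℕ → ℝ → ℝ} {S : ℝ → ℝ} {L M δ : ℝ} (hδ : 0 < δ)
    (hδ₁ : δ ≤ 1)
    (hV : Tendsto (fun z : ℕ × ℝ => V z.1 z.2) (atTop ×ˢ 𝓝[>] 0) (𝓝 L))
    (hM : ∀ p, 0 < p → p < δ → ∀ r, |V r p| ≤ M)
    (hS : ∀ p, 0 < p → p < δ → HasSum (fun r => ((1 - p) ^ r * p) * V r p) (S p)) :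
    Tendsto S (𝓝[>] 0) (𝓝 L) := by
  rw [Metric.tendsto_nhds]
  intro ε hε
  have h1 := (Metric.tendsto_nhds.1 hV) (ε / 2) (half_pos hε)
  obtain ⟨P, hP, Q, hQ, hPQ⟩ := eventually_prod_iff.1 h1
  obtain ⟨N, hN⟩ := eventually_atTop.1 hP
  have h2 : Tendsto (fun p : ℝ => p * (N * (M + |L|))) (𝓝[>] 0) (𝓝 0) := by
    have : Tendsto (fun p : ℝ => p * (N * (M + |L|))) (𝓝 0) (𝓝 (0 * (N * (M + |L|)))) :=
      tendsto_id.mul_const _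
    rw [zero_mul] at this
    exact this.mono_left nhdsWithin_le_nhds
  filter_upwards [hQ, h2.eventually_lt_const (half_pos hε), Ioo_mem_nhdsGT hδ] with p hp hp2 hpδ
  obtain ⟨hp0, hpδ⟩ := hpδ
  have hq0 : 0 ≤ 1 - p := by linarith
  have hq1 : 1 - p < 1 := by linarith
  have hgeo : HasSum (fun r : ℕ => (1 - p) ^ r * p) 1 := by
    have := (hasSum_geometric_of_lt_one hq0 hq1).mul_right p
    rwa [sub_sub_cancel, inv_mul_cancel₀ hp0.ne'] at this
  have hd : HasSum (fun r => ((1 - p) ^ r * p) * (V r p - L)) (S p - L) := by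
    have := (hS p hp0 hpδ).sub (hgeo.mul_right L)
    rw [one_mul] at this
    exact this.congr_fun fun r => by ring
  -- Indices below `N` have weight at most `p` each and deviation at most `M + |L|`, so together
  -- they contribute `O(p)`. All other deviations are below `ε / 2`.
  have hfin : HasSum (fun r => if r ∈ Finset.range N then p * (M + |L|) else 0)
      (p * (N * (M + |L|))) := by
    have := hasSum_sum_of_ne_finset_zero (s := Finset.range N)
      (f := fun r => if r ∈ Finset.range N then p * (M + |L|) else 0)
      (L := SummationFilter.unconditional ℕ) fun r hr => if_neg hr
    rw [Finset.sum_ite_mem, Finset.inter_self, Finset.sum_const, Finset.card_range,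
      nsmul_eq_mul] at this
    convert this using 1
    ring
  have hub := (hgeo.mul_right (ε / 2)).add hfin
  have hterm (r : ℕ) : |((1 - p) ^ r * p) * (V r p - L)| ≤
      ((1 - p) ^ r * p) * (ε / 2) + if r ∈ Finset.range N then p * (M + |L|) else 0 := by
    have hw : 0 ≤ (1 - p) ^ r * p := mul_nonneg (pow_nonneg hq0 r) hp0.le
    rw [abs_mul, abs_of_nonneg hw]
    split_ifs with hr
    · have h3 : |V r p - L| ≤ M + |L| := (abs_sub _ _).trans (by grw [hM p hp0 hpδ r])
      have h4 : (1 - p) ^ r * p ≤ p := mul_le_of_le_one_left hp0.le (pow_le_one₀ hq0 hq1.le)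
      have h5 := mul_le_mul h4 h3 (abs_nonneg _) hp0.le
      have h6 : 0 ≤ ((1 - p) ^ r * p) * (ε / 2) := mul_nonneg hw (by linarith)
      linarith
    · rw [Finset.mem_range, not_lt] at hr
      have h3 : dist (V r p) L < ε / 2 := hPQ (hN r hr) hp
      rw [Real.dist_eq] at h3
      have := mul_le_mul_of_nonneg_left h3.le hw
      linarith
  rw [Real.dist_eq]
  have habs : |S p - L| ≤ 1 * (ε / 2) + p * (N * (M + |L|)) := by
    rw [abs_le]
    exact ⟨hasSum_le (fun r => (abs_le.1 (hterm r)).1) hub.neg hd,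
      hasSum_le (fun r => (abs_le.1 (hterm r)).2) hd hub⟩
  linarith

theorem hasSum_inv_mul_geometric {p : ℝ} (hp₀ : 0 < p) (hp₁ : p < 1) (M : ℝ) :
    HasSum (fun r : ℕ => ((1 - p) ^ r * p) * (M / r)) (M * (p * Real.log (1 / p))) := by
  have h := Real.hasSum_pow_div_log_of_abs_lt_one (x := 1 - p)
    (by rw [abs_lt]; constructor <;> linarith)
  rw [sub_sub_cancel] at h
  -- The term `r = 0` vanishes since `M / 0 = 0`; the rest is the series of `-log (1 - x)` at `x = 1
  -- - p`.
  rw [← hasSum_nat_add_iff' 1]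
  have h' := (h.mul_left (M * p)).congr_fun
    (g := fun n : ℕ => ((1 - p) ^ (n + 1) * p) * (M / (n + 1 : ℕ))) fun n => by push_cast; ring
  simpa [mul_assoc] using h'

/-- The left side equals `q ^ (r - k) * (b / q) ^ (k - 1) / q`, whose two bases are at most `η` and
whose exponents add up to `r - 1`. -/
theorem pow_mul_inv_sq_mul_pow_le {q b η : ℝ} (hq₀ : 0 < q) (hb : 0 ≤ b) (hη : 0 < η)
    (hqη : q ≤ η) (hbη : b / q ≤ η) {k r : ℕ} (hk : 1 ≤ k) (hkr : k ≤ r) :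
    q ^ r * (1 / q ^ k) ^ 2 * b ^ (k - 1) ≤ η ^ r / (q * η) := by
  obtain ⟨k, rfl⟩ := Nat.exists_eq_add_of_le' hk
  obtain ⟨n, rfl⟩ := Nat.exists_eq_add_of_le' hkr
  have e : q ^ (n + (k + 1)) * (1 / q ^ (k + 1)) ^ 2 * b ^ k = q ^ n * (b / q) ^ k / q := by
    rw [div_pow, div_pow, pow_add, pow_succ q k]
    field_simp
  have e' : η ^ (n + (k + 1)) / (q * η) = η ^ n * η ^ k / q := by
    rw [pow_add η n, pow_succ η k]
    field_simp
  rw [Nat.add_sub_cancel, e, e']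
  gcongr

theorem summable_pow_mul_sum_of_lt {q b s : ℝ} (hq₀ : 0 < q) (hq₁ : q < 1) (hb : 0 ≤ b)
    (hbq : b < q) (hs : 0 ≤ s) (d : ℝ) :
    Summable fun r : ℕ => q ^ r * (r * ∑ k ∈ Finset.Icc 1 r,
      (1 / q ^ k) ^ 2 * (s * b ^ (k - 1)) * (d * k) ^ 2) := by
  -- `b / q < 1` is where `b < q` enters; for `q = 1 - p` this is the condition `p < 1 - β²`.
  obtain ⟨η, hη0, hη1, hqη, hbη⟩ : ∃ η : ℝ, 0 < η ∧ η < 1 ∧ q ≤ η ∧ b / q ≤ η :=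
    ⟨max q (b / q), hq₀.trans_le (le_max_left _ _), max_lt hq₁ ((div_lt_one hq₀).2 hbq),
      le_max_left _ _, le_max_right _ _⟩
  have hpow : Summable fun r : ℕ => (r : ℝ) ^ 4 * η ^ r :=
    summable_pow_mul_geometric_of_norm_lt_one 4 (by rwa [Real.norm_of_nonneg hη0.le])
  have hsum : Summable fun r : ℕ => s * d ^ 2 / q / η * ((r : ℝ) ^ 4 * η ^ r) :=
    hpow.mul_left (s * d ^ 2 / q / η)
  have hle (r : ℕ) : q ^ r * (r * ∑ k ∈ Finset.Icc 1 r,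
      (1 / q ^ k) ^ 2 * (s * b ^ (k - 1)) * (d * k) ^ 2) ≤
        s * d ^ 2 / q / η * ((r : ℝ) ^ 4 * η ^ r) := by
    have hterm (k : ℕ) (hk : k ∈ Finset.Icc 1 r) :
        q ^ r * ((1 / q ^ k) ^ 2 * (s * b ^ (k - 1)) * (d * k) ^ 2) ≤
          s * d ^ 2 / q / η * ((r : ℝ) ^ 2 * η ^ r) := by
      obtain ⟨hk1, hkr⟩ := Finset.mem_Icc.1 hk
      have h2 : (k : ℝ) ≤ r := by exact_mod_cast hkr
      calc _ = (q ^ r * (1 / q ^ k) ^ 2 * b ^ (k - 1)) * (s * d ^ 2 * (k : ℝ) ^ 2) := by ring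
        _ ≤ (η ^ r / (q * η)) * (s * d ^ 2 * (r : ℝ) ^ 2) := by
            refine mul_le_mul (pow_mul_inv_sq_mul_pow_le hq₀ hb hη0 hqη hbη hk1 hkr) ?_
              (by positivity) (by positivity)
            gcongr
        _ = _ := by
            rw [div_div]
            ring
    calc q ^ r * (r * ∑ k ∈ Finset.Icc 1 r,
          (1 / q ^ k) ^ 2 * (s * b ^ (k - 1)) * (d * k) ^ 2)
        = r * ∑ k ∈ Finset.Icc 1 r,
          q ^ r * ((1 / q ^ k) ^ 2 * (s * b ^ (k - 1)) * (d * k) ^ 2) := by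
          rw [← Finset.mul_sum]
          ring
      _ ≤ r * ∑ k ∈ Finset.Icc 1 r, s * d ^ 2 / q / η * ((r : ℝ) ^ 2 * η ^ r) := by
          exact mul_le_mul_of_nonneg_left (Finset.sum_le_sum hterm) (Nat.cast_nonneg r)
      _ = _ := by
          rw [Finset.sum_const, Nat.card_Icc, nsmul_eq_mul, Nat.add_sub_cancel]
          ring
  have hnn (r : ℕ) : 0 ≤ q ^ r * (r * ∑ k ∈ Finset.Icc 1 r,
      (1 / q ^ k) ^ 2 * (s * b ^ (k - 1)) * (d * k) ^ 2) := by positivity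
  exact hsum.of_nonneg_of_le hnn hle

/-! ### The estimator with `R` frozen, and square integrability -/

section Estimator

variable {Ω : Type*} [MeasurableSpace Ω] {μ : Measure Ω}
  {f : ℝ → ℝ} {x₀ : ℝ} {m : ℝ → ℝ} {θ : ℝ} {X G : ℕ → Ω → ℝ} {R : ℝ → Ω → ℕ}

/-- `gradSumEst` on the event `R = r`, where `P(R ≥ k) = q ^ k`. -/
noncomputable def partialEst (f : ℝ → ℝ) (x₀ : ℝ) (W : ℕ → ℕ → Ω → ℝ) (q : ℝ) (r : ℕ) (ω : Ω) : ℝ :=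
  ∑ k ∈ Finset.Icc 1 r, 1 / q ^ k * W r k ω * (k * taylorCoeff f x₀ k / x₀)

/-- The properties of the estimates `W` of `(m / x₀ - 1)^(k-1) ∇m` shared by the simple and the
cycling ones. -/
structure IsPowerEstimate (μ : Measure Ω) (x₀ m : ℝ) (X G : ℕ → Ω → ℝ) (W : ℕ → ℕ → Ω → ℝ) :
    Prop where
  factor : ∃ w : ℕ → ℕ → (ℕ → ℝ × ℝ) → ℝ, (∀ r k, Measurable (w r k)) ∧
    ∀ r k ω, W r k ω = w r k (fun i => (X i ω, G i ω))
  memLp : ∀ r k, 1 ≤ k → k ≤ r → MemLp (W r k) 2 μ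
  mean : ∀ r k, 1 ≤ k → k ≤ r →
    ∫ ω, W r k ω ∂μ = (∫ ω, G 0 ω ∂μ) * (m / x₀ - 1) ^ (k - 1)
  sq : ∀ r k, 1 ≤ k → k ≤ r →
    ∫ ω, W r k ω ^ 2 ∂μ ≤ (∫ ω, G 0 ω ^ 2 ∂μ) * betaSq μ x₀ m X ^ (k - 1)

theorem sq_ratio_le_betaSq : (m θ / x₀ - 1) ^ 2 ≤ betaSq μ x₀ (m θ) X := by
  unfold betaSq
  have : 0 ≤ variance (X 0) μ / x₀ ^ 2 := div_nonneg (variance_nonneg _ _) (sq_nonneg _)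
  linarith

theorem abs_coeff_le {c : ℝ} (hc : ∀ k : ℕ, |taylorCoeff f x₀ k| ≤ c) (k : ℕ) :
    |k * taylorCoeff f x₀ k / x₀| ≤ c / |x₀| * k := by
  rw [abs_div, abs_mul, Nat.abs_cast]
  calc (k : ℝ) * |taylorCoeff f x₀ k| / |x₀| ≤ k * c / |x₀| := by
        gcongr
        exact hc k
    _ = _ := by ring

/-- The freezing lemmas require a function of the whole sequence of pairs, the object of which `R`
is independent. -/
theorem IsPowerEstimate.exists_factor_partialEst {W : ℕ → ℕ → Ω → ℝ} {b : ℝ}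
    (hW : IsPowerEstimate μ x₀ b X G W) (f : ℝ → ℝ) (q : ℝ) :
    ∃ u : ℕ → (ℕ → ℝ × ℝ) → ℝ, (∀ r, Measurable (u r)) ∧
      ∀ r ω, partialEst f x₀ W q r ω = u r (fun i => (X i ω, G i ω)) := by
  obtain ⟨w, hw, hWw⟩ := hW.factor
  refine ⟨partialEst f x₀ w q, fun r => ?_, fun r ω => by simp only [partialEst, hWw]⟩
  unfold partialEst
  fun_prop

theorem IsPowerEstimate.memLp_partialEst {W : ℕ → ℕ → Ω → ℝ} {b : ℝ}
    (hW : IsPowerEstimate μ x₀ b X G W) (q : ℝ) (r : ℕ) : MemLp (partialEst f x₀ W q r) 2 μ := by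
  refine memLp_finsetSum (Finset.Icc 1 r) fun k hk => ?_
  obtain ⟨hk1, hkr⟩ := Finset.mem_Icc.1 hk
  exact ((hW.memLp r k hk1 hkr).const_mul _).mul_const _

theorem IsPowerEstimate.integral_partialEst [IsProbabilityMeasure μ] {W : ℕ → ℕ → Ω → ℝ} {b : ℝ}
    (hW : IsPowerEstimate μ x₀ b X G W) (q : ℝ) (r : ℕ) : ∫ ω, partialEst f x₀ W q r ω ∂μ =
    ∑ k ∈ Finset.Icc 1 r, 1 / q ^ k * ((∫ ω, G 0 ω ∂μ) * (b / x₀ - 1) ^ (k - 1)) *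
      (k * taylorCoeff f x₀ k / x₀) := by
  unfold partialEst
  rw [integral_finsetSum]
  · refine Finset.sum_congr rfl fun k hk => ?_
    obtain ⟨hk1, hkr⟩ := Finset.mem_Icc.1 hk
    rw [integral_mul_const, integral_const_mul, hW.mean r k hk1 hkr]
  · intro k hk
    obtain ⟨hk1, hkr⟩ := Finset.mem_Icc.1 hk
    exact (((hW.memLp r k hk1 hkr).integrable one_le_two).const_mul _).mul_const _

namespace GradientSetting

variable [IsProbabilityMeasure μ] (h : GradientSetting μ f x₀ m θ X G R)

include h

theorem isPowerEstimate_simpleW : IsPowerEstimate μ x₀ (m θ) X G (simpleW x₀ X G) where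
  factor := by
    refine ⟨simpleW x₀ (fun i z => (z i).1) (fun i z => (z i).2), fun r k => ?_,
      fun r k ω => rfl⟩
    unfold simpleW
    fun_prop
  memLp r k hk _ := (h.memLp_and_integral_simpleW hk r).1
  mean r k hk _ := (h.memLp_and_integral_simpleW hk r).2.1
  sq r k hk _ := (h.memLp_and_integral_simpleW hk r).2.2.le

theorem isPowerEstimate_cyclingW : IsPowerEstimate μ x₀ (m θ) X G (cyclingW x₀ X G) where
  factor := by
    refine ⟨cyclingW x₀ (fun i z => (z i).1) (fun i z => (z i).2), fun r k => ?_,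
      fun r k ω => rfl⟩
    unfold cyclingW simpleW
    fun_prop
  memLp _ _ hk hkr := (h.memLp_and_integral_cyclingW hk hkr).1
  mean _ _ hk hkr := (h.memLp_and_integral_cyclingW hk hkr).2.1
  sq _ _ hk hkr := (h.memLp_and_integral_cyclingW hk hkr).2.2

/-- The uniform bound behind all three asymptotic claims. The leading factor `k` absorbs the `k ^ 2`
overlaps in the variance of the cycling estimate; elsewhere it is discarded. -/
theorem exists_geometric_bound : ∃ K ρ δ : ℝ, 0 ≤ K ∧ 0 < ρ ∧ ρ < 1 ∧ 0 < δ ∧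
    δ ≤ 1 - betaSq μ x₀ (m θ) X ∧ δ ≤ 1 / 2 ∧
    ∀ p, 0 < p → p < δ → ∀ k : ℕ, k * (1 / (1 - p) ^ k * (√(∫ ω, G 0 ω ^ 2 ∂μ) *
      √(betaSq μ x₀ (m θ) X) ^ (k - 1)) * |k * taylorCoeff f x₀ k / x₀|) ≤ K * ρ ^ k := by
  set b := betaSq μ x₀ (m θ) X
  set s := √(∫ ω, G 0 ω ^ 2 ∂μ) with hs_def
  have hs0 : 0 ≤ s := Real.sqrt_nonneg _
  have hb0 : 0 ≤ b := h.betaSq_nonneg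
  have hb1 : b < 1 := h.betaSq_lt_one
  obtain ⟨c, hc0, hc⟩ := h.taylor.bounded
  have hx : 0 < |x₀| := abs_pos.2 h.x₀_ne_zero
  have ht0 : 0 ≤ √b := Real.sqrt_nonneg b
  have ht1 : √b < 1 := by rw [Real.sqrt_lt' one_pos]; simpa using hb1
  have hbt : b ≤ √b := by nlinarith [Real.sq_sqrt hb0]
  -- `σ` lies strictly between `√b` and `1`, hence is positive even if `b = 0`, which permits `√b ^
  -- (k - 1) ≤ σ ^ k / σ`. Then `q₀` lies strictly between `σ` and `1`, and `p < 1 - q₀` keeps the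
  -- ratio below `σ / q₀ < 1`.
  set σ := (1 + √b) / 2 with hσ
  have hσ0 : 0 < σ := by linarith
  have hσ1 : σ < 1 := by linarith
  set q₀ := (1 + σ) / 2 with hq₀
  have hq0 : 0 < q₀ := by linarith
  clear_value σ q₀ s
  obtain ⟨K, ρ, hK, hρ0, hρ1, hKρ⟩ := exists_sq_mul_pow_le_geometric (x := σ / q₀)
    (div_pos hσ0 hq0) ((div_lt_one hq0).2 (by linarith))
  refine ⟨c / |x₀| * s / σ * K, ρ, 1 - q₀, by positivity, hρ0, hρ1, by linarith, by linarith,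
    by linarith, fun p hp0 hp k => ?_⟩
  rcases Nat.eq_zero_or_pos k with rfl | hk
  · simp
    positivity
  have h1 : 1 / (1 - p) ^ k ≤ 1 / q₀ ^ k := by
    gcongr
    linarith
  have h2 : √b ^ (k - 1) ≤ σ ^ k / σ := by
    rw [le_div_iff₀ hσ0]
    calc √b ^ (k - 1) * σ ≤ σ ^ (k - 1) * σ := by
          gcongr
          linarith
      _ = σ ^ k := by rw [← pow_succ, Nat.sub_add_cancel hk]
  have hp1 : 0 < 1 - p := by linarith
  calc _ ≤ k * (1 / q₀ ^ k * (s * (σ ^ k / σ)) * (c / |x₀| * k)) := by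
        gcongr
        exact abs_coeff_le hc k
    _ = c / |x₀| * s / σ * ((k : ℝ) ^ 2 * (σ / q₀) ^ k) := by
        rw [div_pow]
        field_simp
    _ ≤ c / |x₀| * s / σ * (K * ρ ^ k) := by
        exact mul_le_mul_of_nonneg_left (hKρ k) (by positivity)
    _ = _ := by ring

variable {W : ℕ → ℕ → Ω → ℝ} (hW : IsPowerEstimate μ x₀ (m θ) X G W)

theorem gradSumEst_eq {p : ℝ} (hp₀ : 0 < p) (hp₁ : p < 1 - betaSq μ x₀ (m θ) X) (ω : Ω) :
    gradSumEst μ f x₀ (R p) W ω = partialEst f x₀ W (1 - p) (R p ω) ω := by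
  have hp1 : p ≤ 1 := by linarith [h.betaSq_nonneg]
  have hne : (⟨p, hp₀.le, hp1⟩ : unitInterval) ≠ 0 := fun h => hp₀.ne' (congrArg Subtype.val h)
  unfold gradSumEst partialEst
  simp only [measureReal_ge_geometric hne (h.law_R p hp₀ hp1 hp₁)]

include hW

/-- Cauchy–Schwarz over the `r` summands avoids any information about their correlations. -/
theorem integral_partialEst_sq_le {c : ℝ} (hc : ∀ k : ℕ, |taylorCoeff f x₀ k| ≤ c)
    {q : ℝ} (hq₀ : 0 < q) (r : ℕ) :
    ∫ ω, partialEst f x₀ W q r ω ^ 2 ∂μ ≤ r * ∑ k ∈ Finset.Icc 1 r,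
      (1 / q ^ k) ^ 2 * ((∫ ω, G 0 ω ^ 2 ∂μ) * betaSq μ x₀ (m θ) X ^ (k - 1)) *
        (c / |x₀| * k) ^ 2 := by
  have hle (ω : Ω) : partialEst f x₀ W q r ω ^ 2 ≤ r * ∑ k ∈ Finset.Icc 1 r,
      (1 / q ^ k * W r k ω * (k * taylorCoeff f x₀ k / x₀)) ^ 2 := by
    have := sq_sum_le_card_mul_sum_sq (s := Finset.Icc 1 r) (f := fun k =>
      1 / q ^ k * W r k ω * (k * taylorCoeff f x₀ k / x₀))
    simpa [partialEst] using this
  have hi (k : ℕ) (hk : k ∈ Finset.Icc 1 r) : Integrable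
      (fun ω => (1 / q ^ k * W r k ω * (k * taylorCoeff f x₀ k / x₀)) ^ 2) μ := by
    obtain ⟨hk1, hkr⟩ := Finset.mem_Icc.1 hk
    exact (((hW.memLp r k hk1 hkr).const_mul _).mul_const _).integrable_sq
  refine (integral_mono (hW.memLp_partialEst q r).integrable_sq
    ((integrable_finsetSum _ hi).const_mul _) hle).trans ?_
  rw [integral_const_mul, integral_finsetSum _ hi]
  refine mul_le_mul_of_nonneg_left (Finset.sum_le_sum fun k hk => ?_) (Nat.cast_nonneg r)
  obtain ⟨hk1, hkr⟩ := Finset.mem_Icc.1 hk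
  simp only [mul_pow]
  rw [integral_mul_const, integral_const_mul]
  have hb := h.betaSq_nonneg
  have hs : 0 ≤ ∫ ω, G 0 ω ^ 2 ∂μ := integral_nonneg fun _ => sq_nonneg _
  have h1 := hW.sq r k hk1 hkr
  have h2 : (k * taylorCoeff f x₀ k / x₀) ^ 2 ≤ (c / |x₀| * k) ^ 2 :=
    sq_le_sq.2 ((abs_coeff_le hc k).trans (le_abs_self _))
  rw [← mul_pow (c / |x₀|)]
  gcongr

theorem memLp_gradSumEst {p : ℝ} (hp₀ : 0 < p) (hp₁ : p < 1 - betaSq μ x₀ (m θ) X) :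
    MemLp (gradSumEst μ f x₀ (R p) W) 2 μ := by
  have hb0 := h.betaSq_nonneg
  have hp1 : p ≤ 1 := by linarith
  have hne : (⟨p, hp₀.le, hp1⟩ : unitInterval) ≠ 0 := fun h => hp₀.ne' (congrArg Subtype.val h)
  obtain ⟨u, hu, hF⟩ := hW.exists_factor_partialEst f (1 - p)
  obtain ⟨c, hc0, hc⟩ := h.taylor.bounded
  rw [funext (h.gradSumEst_eq hp₀ hp₁)]
  simp only [hF]
  refine memLp_two_of_indepFun_geometric (u := u) hne
    (h.measurable_R p hp₀ hp₁) (h.law_R p hp₀ hp1 hp₁) (Z := fun ω i => (X i ω, G i ω))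
    (measurable_pi_lambda _ fun i => (h.measurable_X i).prodMk (h.measurable_G i))
    (h.indep_R p hp₀ hp₁) hu (fun r => ?_) ?_
  · simp only [← hF]
    exact hW.memLp_partialEst _ _
  simp only [← hF]
  have hs : 0 ≤ ∫ ω, G 0 ω ^ 2 ∂μ := integral_nonneg fun _ => sq_nonneg _
  refine Summable.of_nonneg_of_le (fun r => mul_nonneg (mul_nonneg (pow_nonneg (by linarith) r)
    hp₀.le) (integral_nonneg fun _ => sq_nonneg _)) (fun r => ?_)
    (summable_pow_mul_sum_of_lt (q := 1 - p) (by linarith) (by linarith) hb0 (by linarith) hs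
      (c / |x₀|))
  refine (mul_le_mul_of_nonneg_left (h.integral_partialEst_sq_le hW hc (by linarith) r)
    (mul_nonneg (pow_nonneg (by linarith) r) hp₀.le)).trans ?_
  refine mul_le_mul_of_nonneg_right (mul_le_of_le_one_right (pow_nonneg (by linarith) r) hp1) ?_
  exact mul_nonneg (Nat.cast_nonneg r) (Finset.sum_nonneg fun k _ => mul_nonneg (mul_nonneg
    (sq_nonneg _) (mul_nonneg hs (pow_nonneg hb0 _))) (sq_nonneg _))

theorem hasSum_expCondVar_gradSumEst {p : ℝ} (hp₀ : 0 < p)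
    (hp₁ : p < 1 - betaSq μ x₀ (m θ) X) :
    HasSum (fun r => ((1 - p) ^ r * p) * variance (partialEst f x₀ W (1 - p) r) μ)
      (expCondVar μ (R p) (gradSumEst μ f x₀ (R p) W)) := by
  have hb0 := h.betaSq_nonneg
  have hp1 : p ≤ 1 := by linarith
  have hne : (⟨p, hp₀.le, hp1⟩ : unitInterval) ≠ 0 := fun h => hp₀.ne' (congrArg Subtype.val h)
  obtain ⟨u, hu, hF⟩ := hW.exists_factor_partialEst f (1 - p)
  have hL := h.memLp_gradSumEst hW hp₀ hp₁
  rw [funext (h.gradSumEst_eq hp₀ hp₁)] at hL ⊢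
  rw [show (fun r => ((1 - p) ^ r * p) * variance (partialEst f x₀ W (1 - p) r) μ) =
    fun r => ((1 - p) ^ r * p) * variance
      (fun ω => u r (fun i => (X i ω, G i ω))) μ by simp only [← hF]]
  simp only [hF] at hL ⊢
  have key := hasSum_expCondVar (u := u) hne
    (h.measurable_R p hp₀ hp₁) (h.law_R p hp₀ hp1 hp₁) (Z := fun ω i => (X i ω, G i ω))
    (measurable_pi_lambda _ fun i => (h.measurable_X i).prodMk (h.measurable_G i))
    (h.indep_R p hp₀ hp₁) hu hL
  exact key

theorem varCondExp_gradSumEst_le {p : ℝ} (hp₀ : 0 < p) (hp₁ : p < 1 - betaSq μ x₀ (m θ) X)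
    {c K ρ : ℝ} (hρ₀ : 0 ≤ ρ) (hρ₁ : ρ < 1)
    (hK : ∀ r, |∫ ω, partialEst f x₀ W (1 - p) r ω ∂μ - c| ≤ K * ρ ^ r) :
    varCondExp μ (R p) (gradSumEst μ f x₀ (R p) W) ≤ K ^ 2 / (1 - ρ ^ 2) * p := by
  have hb0 := h.betaSq_nonneg
  have hp1 : p ≤ 1 := by linarith
  have hne : (⟨p, hp₀.le, hp1⟩ : unitInterval) ≠ 0 := fun h => hp₀.ne' (congrArg Subtype.val h)
  obtain ⟨u, hu, hF⟩ := hW.exists_factor_partialEst f (1 - p)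
  have hL := h.memLp_gradSumEst hW hp₀ hp₁
  rw [funext (h.gradSumEst_eq hp₀ hp₁)] at hL ⊢
  simp only [hF] at hL hK ⊢
  refine varCondExp_le_of_abs_sub_le (u := u) hne
    (h.measurable_R p hp₀ hp₁) (h.law_R p hp₀ hp1 hp₁) (Z := fun ω i => (X i ω, G i ω))
    (measurable_pi_lambda _ fun i => (h.measurable_X i).prodMk (h.measurable_G i))
    (h.indep_R p hp₀ hp₁) hu hL hρ₀ hρ₁ hK

end GradientSetting

end Estimator

/-! ### Behaviour as `p → 0` -/

section Asymptotics

variable {Ω : Type*} [MeasurableSpace Ω] {μ : Measure Ω} [IsProbabilityMeasure μ]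
  {f : ℝ → ℝ} {x₀ : ℝ} {m : ℝ → ℝ} {θ : ℝ} {X G : ℕ → Ω → ℝ} {R : ℝ → Ω → ℕ}

theorem sum_Icc_pow_le {ρ : ℝ} (hρ₀ : 0 ≤ ρ) (hρ₁ : ρ < 1) (r : ℕ) :
    ∑ k ∈ Finset.Icc 1 r, ρ ^ k ≤ (1 - ρ)⁻¹ :=
  sum_le_hasSum _ (fun _ _ => pow_nonneg hρ₀ _) (hasSum_geometric_of_lt_one hρ₀ hρ₁)

theorem le_mul_of_one_le_natCast {k : ℕ} {x : ℝ} (hk : 1 ≤ k) (hx : 0 ≤ x) : x ≤ k * x :=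
  le_mul_of_one_le_left hx (by exact_mod_cast hk)

namespace GradientSetting

variable (h : GradientSetting μ f x₀ m θ X G R) {W : ℕ → ℕ → Ω → ℝ}

include h

theorem abs_integral_G_le : |∫ ω, G 0 ω ∂μ| ≤ √(∫ ω, G 0 ω ^ 2 ∂μ) := by
  refine Real.abs_le_sqrt ?_
  have h1 := variance_eq_sub h.memLp_G
  have h2 := variance_nonneg (G 0) μ
  simp only [Pi.pow_apply] at h1
  linarith

theorem isBigO_varCondExp (hW : IsPowerEstimate μ x₀ (m θ) X G W) :
    (fun p : ℝ => varCondExp μ (R p) (gradSumEst μ f x₀ (R p) W)) =O[𝓝[>] 0] (fun p : ℝ => p) := by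
  obtain ⟨K, ρ, δ, hK, hρ0, hρ1, hδ, hδb, hδ1, hbd⟩ := h.exists_geometric_bound
  refine IsBigO.of_bound ((K * ρ / (1 - ρ)) ^ 2 / (1 - ρ ^ 2)) ?_
  filter_upwards [Ioo_mem_nhdsGT hδ] with p hp
  obtain ⟨hp0, hpδ⟩ := hp
  have hp1 : 0 < 1 - p := by linarith
  set t : ℕ → ℝ := fun k => 1 / (1 - p) ^ k *
    ((∫ ω, G 0 ω ∂μ) * (m θ / x₀ - 1) ^ (k - 1)) * (k * taylorCoeff f x₀ k / x₀) with ht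
  have htb (k : ℕ) : |t k| ≤ K * ρ ^ k := by
    rcases Nat.eq_zero_or_pos k with rfl | hk
    · simpa [ht] using hK
    refine le_trans ?_ (hbd p hp0 hpδ k)
    refine le_trans ?_ (le_mul_of_one_le_natCast hk (by positivity))
    rw [ht]
    simp only [abs_mul, abs_pow]
    rw [abs_of_pos (show 0 < 1 / (1 - p) ^ k by positivity)]
    gcongr
    · exact h.abs_integral_G_le
    · exact Real.abs_le_sqrt sq_ratio_le_betaSq
  have hsummable : Summable t := Summable.of_norm_bounded
    ((summable_geometric_of_lt_one hρ0.le hρ1).mul_left K) htb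
  -- The factor `k` makes `t 0 = 0`, so starting the sum at `0` is harmless.
  have hpart (r : ℕ) : ∫ ω, partialEst f x₀ W (1 - p) r ω ∂μ = ∑ k ∈ Finset.range (r + 1), t k := by
    have e : Finset.range (r + 1) = insert 0 (Finset.Icc 1 r) := by
      ext k
      simp only [Finset.mem_range, Finset.mem_insert, Finset.mem_Icc]
      omega
    rw [hW.integral_partialEst, e, Finset.sum_insert (by simp)]
    simp [ht]
  -- The tail after `r` is at most `∑ K * ρ ^ k` over `k > r`. The limit depends on `p`, but the
  -- constants do not.
  have hmean (r : ℕ) : |∫ ω, partialEst f x₀ W (1 - p) r ω ∂μ - ∑' k, t k| ≤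
      (K * ρ / (1 - ρ)) * ρ ^ r := by
    rw [hpart, ← Real.dist_eq]
    have hlim := (tendsto_add_atTop_iff_nat 1).2 hsummable.hasSum.tendsto_sum_nat
    refine (dist_le_of_le_geometric_of_tendsto ρ (K * ρ) hρ1 (fun n => ?_) hlim r).trans_eq
      (by ring)
    rw [dist_comm, Real.dist_eq, Finset.sum_range_succ _ (n + 1), add_sub_cancel_left]
    exact (htb (n + 1)).trans_eq (by ring)
  have hpb : p < 1 - betaSq μ x₀ (m θ) X := hpδ.trans_le hδb
  rw [Real.norm_of_nonneg hp0.le, varCondExp, Real.norm_of_nonneg (variance_nonneg _ _)]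
  exact h.varCondExp_gradSumEst_le hW hp0 hpb hρ0.le hρ1 hmean

theorem variance_simpleW_le {k : ℕ} (hk : 1 ≤ k) (r : ℕ) : variance (simpleW x₀ X G r k) μ ≤
    (√(∫ ω, G 0 ω ^ 2 ∂μ) * √(betaSq μ x₀ (m θ) X) ^ (k - 1)) ^ 2 := by
  have h1 := h.memLp_and_integral_simpleW hk r
  refine (variance_le_expectation_sq h1.1.aestronglyMeasurable).trans (h1.2.2.trans ?_).le
  rw [mul_pow, ← pow_mul, mul_comm (k - 1) 2, pow_mul, Real.sq_sqrt h.betaSq_nonneg,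
    Real.sq_sqrt (integral_nonneg fun _ => sq_nonneg _)]

/-- The expected conditional variance of the simple estimator converges to the variance of the
full series. -/
theorem tendsto_expCondVar_simpleW :
    Tendsto (fun p : ℝ => expCondVar μ (R p) (gradSumEst μ f x₀ (R p) (simpleW x₀ X G))) (𝓝[>] 0)
      (𝓝 (∑' z : ℕ × ℕ, (z.1 * taylorCoeff f x₀ z.1 / x₀) * (z.2 * taylorCoeff f x₀ z.2 / x₀) *
        covariance (simpleW x₀ X G z.1 z.1) (simpleW x₀ X G z.2 z.2) μ)) ∧
    Summable (fun z : ℕ × ℕ => (z.1 * taylorCoeff f x₀ z.1 / x₀) *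
      (z.2 * taylorCoeff f x₀ z.2 / x₀) *
        covariance (simpleW x₀ X G z.1 z.1) (simpleW x₀ X G z.2 z.2) μ) := by
  obtain ⟨K, ρ, δ, hK, hρ0, hρ1, hδ, hδb, hδ1, hbd⟩ := h.exists_geometric_bound
  have hW := h.isPowerEstimate_simpleW
  set d : ℕ → ℝ := fun k => k * taylorCoeff f x₀ k / x₀ with hd
  set v : ℕ → ℝ := fun k => √(∫ ω, G 0 ω ^ 2 ∂μ) * √(betaSq μ x₀ (m θ) X) ^ (k - 1) with hv
  have hv0 (k : ℕ) : 0 ≤ v k := by positivity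
  set C : ℕ → ℕ → ℝ := fun k l => covariance (simpleW x₀ X G k k) (simpleW x₀ X G l l) μ with hC
  have hCb (k l : ℕ) (hk : 1 ≤ k) (hl : 1 ≤ l) : |C k l| ≤ v k * v l :=
    abs_covariance_le (hW.memLp k k hk le_rfl) (hW.memLp l l hl le_rfl) (hv0 k) (hv0 l)
      (h.variance_simpleW_le hk k) (h.variance_simpleW_le hl l)
  have hdv (p : ℝ) (hp0 : 0 < p) (hpδ : p < δ) (k : ℕ) (hk : 1 ≤ k) :
      1 / (1 - p) ^ k * v k * |d k| ≤ K * ρ ^ k := by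
    have hp1 : 0 < 1 - p := by linarith
    exact (le_mul_of_one_le_natCast hk (by positivity)).trans (hbd p hp0 hpδ k)
  have hterm (p : ℝ) (hp0 : 0 < p) (hpδ : p < δ) (k l : ℕ) :
      |1 / (1 - p) ^ k * (1 / (1 - p) ^ l) * (d k * d l * C k l)| ≤
        (K * ρ ^ k) * (K * ρ ^ l) := by
    have hp1 : 0 < 1 - p := by linarith
    rcases Nat.eq_zero_or_pos k with rfl | hk
    · simp [hd]
      positivity
    rcases Nat.eq_zero_or_pos l with rfl | hl
    · simp [hd]
      positivity
    simp only [abs_mul]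
    rw [abs_of_pos (show 0 < 1 / (1 - p) ^ k by positivity),
      abs_of_pos (show 0 < 1 / (1 - p) ^ l by positivity)]
    calc _ ≤ 1 / (1 - p) ^ k * (1 / (1 - p) ^ l) * (|d k| * |d l| * (v k * v l)) := by
          gcongr
          exact hCb k l hk hl
      _ = (1 / (1 - p) ^ k * v k * |d k|) * (1 / (1 - p) ^ l * v l * |d l|) := by ring
      _ ≤ _ := mul_le_mul (hdv p hp0 hpδ k hk) (hdv p hp0 hpδ l hl)
          (mul_nonneg (mul_nonneg (by positivity) (hv0 l)) (abs_nonneg _)) (by positivity)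
  have hbsum : Summable fun z : ℕ × ℕ => (K * ρ ^ z.1) * (K * ρ ^ z.2) := by
    have hg := (summable_geometric_of_lt_one hρ0.le hρ1).mul_left K
    exact hg.mul_of_nonneg hg (fun k => by positivity) (fun k => by positivity)
  have hvar (q : ℝ) (r : ℕ) : variance (partialEst f x₀ (simpleW x₀ X G) q r) μ =
      ∑ z ∈ Finset.Icc 1 r ×ˢ Finset.Icc 1 r,
        1 / q ^ z.1 * (1 / q ^ z.2) * (d z.1 * d z.2 * C z.1 z.2) := by
    have hL (k : ℕ) (hk : k ∈ Finset.Icc 1 r) : MemLp (fun ω => 1 / q ^ k * simpleW x₀ X G r k ω *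
        (k * taylorCoeff f x₀ k / x₀)) 2 μ := by
      obtain ⟨hk1, hkr⟩ := Finset.mem_Icc.1 hk
      exact ((hW.memLp r k hk1 hkr).const_mul _).mul_const _
    have e : partialEst f x₀ (simpleW x₀ X G) q r = fun ω => ∑ k ∈ Finset.Icc 1 r,
      1 / q ^ k * simpleW x₀ X G r k ω * (k * taylorCoeff f x₀ k / x₀) := rfl
    rw [e, variance_fun_sum' hL, Finset.sum_product]
    refine Finset.sum_congr rfl fun k _ => Finset.sum_congr rfl fun l _ => ?_
    rw [covariance_mul_const_left, covariance_mul_const_right, covariance_const_mul_left,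
      covariance_const_mul_right]
    -- `simpleW` ignores its first index, so the covariances in row `r` are those in `C`.
    change 1 / q ^ k * (1 / q ^ l * C k l) * d l * d k = _
    ring
  -- Extending the finite double sum by zero fixes the index set, so that dominated convergence
  -- applies in `(r, p)` jointly.
  let T : ℕ × ℝ → ℕ × ℕ → ℝ := fun y z =>
    if z ∈ Finset.Icc 1 y.1 ×ˢ Finset.Icc 1 y.1 then
      1 / (1 - y.2) ^ z.1 * (1 / (1 - y.2) ^ z.2) * (d z.1 * d z.2 * C z.1 z.2) else 0
  have hT (r : ℕ) (p : ℝ) :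
      variance (partialEst f x₀ (simpleW x₀ X G) (1 - p) r) μ = ∑' z, T (r, p) z := by
    rw [hvar, tsum_eq_sum (s := Finset.Icc 1 r ×ˢ Finset.Icc 1 r) fun z hz => if_neg hz]
    exact Finset.sum_congr rfl fun z hz => (if_pos hz).symm
  have hTb (r : ℕ) (p : ℝ) (hp0 : 0 < p) (hpδ : p < δ) (z : ℕ × ℕ) :
      ‖T (r, p) z‖ ≤ (K * ρ ^ z.1) * (K * ρ ^ z.2) := by
    simp only [T]
    split_ifs
    · exact hterm p hp0 hpδ z.1 z.2
    · rw [norm_zero]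
      positivity
  have hTlim (z : ℕ × ℕ) : Tendsto (fun y : ℕ × ℝ => T y z) (atTop ×ˢ 𝓝[>] 0)
      (𝓝 (d z.1 * d z.2 * C z.1 z.2)) := by
    by_cases hz : 1 ≤ z.1 ∧ 1 ≤ z.2
    · have hc : Tendsto (fun y : ℕ × ℝ => 1 / (1 - y.2) ^ z.1 * (1 / (1 - y.2) ^ z.2) *
          (d z.1 * d z.2 * C z.1 z.2)) (atTop ×ˢ 𝓝[>] 0) (𝓝 (d z.1 * d z.2 * C z.1 z.2)) := by
        have h1 : ContinuousAt (fun p : ℝ => 1 / (1 - p) ^ z.1 * (1 / (1 - p) ^ z.2) *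
          (d z.1 * d z.2 * C z.1 z.2)) 0 := by
          have h2 (k : ℕ) : ContinuousAt (fun p : ℝ => 1 / (1 - p) ^ k) 0 :=
            continuousAt_const.div (by fun_prop) (by simp)
          exact ((h2 z.1).mul (h2 z.2)).mul continuousAt_const
        have h3 := h1.tendsto.mono_left (nhdsWithin_le_nhds (s := Set.Ioi 0))
        simp only [sub_zero, one_pow, div_one, one_mul] at h3
        exact h3.comp tendsto_snd
      refine hc.congr' ?_
      filter_upwards [tendsto_fst.eventually (eventually_ge_atTop (max z.1 z.2))] with y hy
      rw [max_le_iff] at hy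
      exact (if_pos (by simp [hz, hy])).symm
    -- A zero coordinate contributes nothing because `d 0 = 0`.
    · have h0 : d z.1 * d z.2 * C z.1 z.2 = 0 := by
        rcases not_and_or.1 hz with hz | hz <;>
        · have : _ = 0 := Nat.lt_one_iff.1 (not_le.1 hz)
          simp [hd, this]
      have h1 (y : ℕ × ℝ) : T y z = 0 := by simp [T, h0]
      simp only [h0, h1]
      exact tendsto_const_nhds
  have hev : ∀ᶠ y : ℕ × ℝ in atTop ×ˢ 𝓝[>] 0, y.2 ∈ Set.Ioo 0 δ :=
    tendsto_snd.eventually (Ioo_mem_nhdsGT hδ)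
  have hlim := tendsto_tsum_of_dominated_convergence hbsum hTlim
    (hev.mono fun y hy z => hTb y.1 y.2 hy.1 hy.2 z)
  have hsummable : Summable fun z : ℕ × ℕ => d z.1 * d z.2 * C z.1 z.2 := by
    refine Summable.of_norm_bounded hbsum fun z => ?_
    exact le_of_tendsto (hTlim z).norm (hev.mono fun y hy => hTb y.1 y.2 hy.1 hy.2 z)
  refine ⟨?_, hsummable⟩
  refine tendsto_geometric_average (V := fun r p =>
    variance (partialEst f x₀ (simpleW x₀ X G) (1 - p) r) μ)
    (M := ∑' z : ℕ × ℕ, (K * ρ ^ z.1) * (K * ρ ^ z.2)) hδ (by linarith) ?_ (fun p hp0 hpδ r => ?_)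
    fun p hp0 hpδ => h.hasSum_expCondVar_gradSumEst hW hp0 (hpδ.trans_le hδb)
  · simp only [hT]
    exact hlim
  · rw [hT]
    exact tsum_of_norm_bounded hbsum.hasSum (hTb r p hp0 hpδ)

/-- The `k`-th summand has standard deviation at most `K * ρ ^ k / √r`. Minkowski's inequality gives
variance `O(1 / r)`, and averaging `1 / r` over the geometric weights produces the logarithm. -/
theorem isBigO_expCondVar_cyclingW :
    (fun p : ℝ => expCondVar μ (R p) (gradSumEst μ f x₀ (R p) (cyclingW x₀ X G)))
      =O[𝓝[>] 0] (fun p : ℝ => p * Real.log (1 / p)) := by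
  obtain ⟨K, ρ, δ, hK, hρ0, hρ1, hδ, hδb, hδ1, hbd⟩ := h.exists_geometric_bound
  have hW := h.isPowerEstimate_cyclingW
  have hs : 0 ≤ ∫ ω, G 0 ω ^ 2 ∂μ := integral_nonneg fun _ => sq_nonneg _
  refine IsBigO.of_bound ((K * (1 - ρ)⁻¹) ^ 2) ?_
  filter_upwards [Ioo_mem_nhdsGT hδ] with p hp
  obtain ⟨hp0, hpδ⟩ := hp
  have hp1 : 0 < 1 - p := by linarith
  have hlog : 0 ≤ Real.log (1 / p) := Real.log_nonneg (by rw [le_div_iff₀ hp0]; linarith)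
  have hvar (r : ℕ) : variance (partialEst f x₀ (cyclingW x₀ X G) (1 - p) r) μ ≤
      (K * (1 - ρ)⁻¹) ^ 2 / r := by
    have hle : variance (partialEst f x₀ (cyclingW x₀ X G) (1 - p) r) μ ≤
        (∑ k ∈ Finset.Icc 1 r, K * ρ ^ k / √r) ^ 2 := by
      refine variance_sum_le_sq_sum (fun k hk => ?_) (fun k _ => by positivity) fun k hk => ?_
      · obtain ⟨hk1, hkr⟩ := Finset.mem_Icc.1 hk
        exact ((hW.memLp r k hk1 hkr).const_mul _).mul_const _
      · obtain ⟨hk1, hkr⟩ := Finset.mem_Icc.1 hk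
        rw [variance_mul_const, variance_const_mul, div_pow _ (√_), Real.sq_sqrt (Nat.cast_nonneg r)]
        calc _ ≤ (1 / (1 - p) ^ k) ^ 2 * (k ^ 2 * ((∫ ω, G 0 ω ^ 2 ∂μ) *
              betaSq μ x₀ (m θ) X ^ (k - 1)) / r) * (k * taylorCoeff f x₀ k / x₀) ^ 2 := by
              gcongr
              exact h.variance_cyclingW_le hk1 hkr
          _ = (k * (1 / (1 - p) ^ k * (√(∫ ω, G 0 ω ^ 2 ∂μ) *
                √(betaSq μ x₀ (m θ) X) ^ (k - 1)) * |k * taylorCoeff f x₀ k / x₀|)) ^ 2 / r := by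
              rw [mul_pow, mul_pow _ |_|, mul_pow, mul_pow (√_), ← pow_mul _ (k - 1) 2,
                mul_comm (k - 1) 2, pow_mul, Real.sq_sqrt h.betaSq_nonneg, Real.sq_sqrt hs, sq_abs]
              ring
          _ ≤ _ := by
              exact div_le_div_of_nonneg_right (pow_le_pow_left₀ (by positivity)
                (hbd p hp0 hpδ k) 2) (Nat.cast_nonneg r)
    refine hle.trans ?_
    rw [← Finset.sum_div, ← Finset.mul_sum, div_pow, Real.sq_sqrt (Nat.cast_nonneg r)]
    gcongr
    exact sum_Icc_pow_le hρ0.le hρ1 r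
  have hsum := h.hasSum_expCondVar_gradSumEst hW hp0 (hpδ.trans_le hδb)
  have hw (r : ℕ) : 0 ≤ (1 - p) ^ r * p := mul_nonneg (pow_nonneg hp1.le r) hp0.le
  rw [Real.norm_of_nonneg (hsum.nonneg fun r => mul_nonneg (hw r) (variance_nonneg _ _)),
    Real.norm_of_nonneg (mul_nonneg hp0.le hlog)]
  exact hasSum_le (fun r => mul_le_mul_of_nonneg_left (hvar r) (hw r)) hsum
    (hasSum_inv_mul_geometric hp0 (by linarith) _)

end GradientSetting

end Asymptotics

/-! ### The Taylor assumption for the logarithm at `1` -/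

section Logarithm

theorem taylorCoeff_log_one_succ (k : ℕ) :
    taylorCoeff Real.log 1 (k + 1) = (-1) ^ k / (k + 1) := by
  have h1 : deriv Real.log = fun x => x⁻¹ := Real.deriv_log'
  have hk : ((k ! : ℕ) : ℝ) ≠ 0 := Nat.cast_ne_zero.2 k.factorial_ne_zero
  rw [taylorCoeff, iteratedDeriv_succ', h1, iteratedDeriv_eq_iterate, iter_deriv_inv,
    Nat.factorial_succ]
  push_cast
  rw [one_zpow, one_pow]
  have : (k : ℝ) + 1 ≠ 0 := by positivity
  field_simp

theorem taylorCoeff_log_one_zero : taylorCoeff Real.log 1 0 = 0 := by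
  simp [taylorCoeff]

theorem abs_taylorCoeff_log_one (k : ℕ) : |taylorCoeff Real.log 1 k| = (k : ℝ)⁻¹ := by
  cases k with
  | zero => simp [taylorCoeff_log_one_zero]
  | succ k =>
    rw [taylorCoeff_log_one_succ, abs_div, abs_pow, abs_neg, abs_one, one_pow, one_div]
    push_cast
    rw [abs_of_pos (by positivity)]

theorem taylorAssumption_log_one : TaylorAssumption Real.log 1 1 where
  smooth := Real.contDiffAt_log.2 one_ne_zero
  hasSum := by
    rw [Real.log_one]
    refine hasSum_zero.congr_fun fun k => ?_
    cases k with
    | zero => simp [taylorCoeff_log_one_zero]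
    | succ k => simp
  bounded := by
    refine ⟨1, one_pos, fun k => ?_⟩
    rw [abs_taylorCoeff_log_one]
    exact Nat.cast_inv_le_one k
  slow g hg0 hg1 := by
    have ht := tendsto_pow_const_mul_const_pow_of_lt_one 1 hg0.le hg1
    refine (isLittleO_iff_tendsto' ?_).2 ?_
    · filter_upwards [eventually_ge_atTop 1] with k hk h0
      rw [abs_taylorCoeff_log_one, inv_eq_zero, Nat.cast_eq_zero] at h0
      omega
    -- Here `|γ_k| = 1 / k`, so the quotient is `k * g ^ k`.
    · refine ht.congr fun k => ?_
      rw [abs_taylorCoeff_log_one, div_inv_eq_mul, pow_one, mul_comm]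
  beta_zero_lt_one := by simp

end Logarithm

/-! ### A Gaussian example with non-zero limit -/

section Example

variable {Ω : Type*} [MeasurableSpace Ω] {μ : Measure Ω} [IsProbabilityMeasure μ]
  {f : ℝ → ℝ} {x₀ : ℝ} {m : ℝ → ℝ} {θ : ℝ} {X G : ℕ → Ω → ℝ} {R : ℝ → Ω → ℕ}

/-- For unit gradient samples and expansion at the mean, the simple estimates are uncorrelated. -/
theorem GradientSetting.covariance_simpleW_eq_zero_of_lt
    (h : GradientSetting μ f x₀ m θ X (fun _ _ => 1) R) (hm : m θ / x₀ - 1 = 0)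
    {k l r s : ℕ} (hk : 1 ≤ k) (hkl : k < l) :
    covariance (simpleW x₀ X (fun _ _ => 1) r k) (simpleW x₀ X (fun _ _ => 1) s l) μ = 0 := by
  have h1 := h.memLp_and_integral_simpleW hk r
  have h2 := h.memLp_and_integral_simpleW (hk.trans hkl.le) s
  have hX := h.measurable_X
  have hzero : (0 : ℝ) ^ (l - 1) = 0 := zero_pow (by omega)
  have h3 : ∫ ω, simpleW x₀ X (fun _ _ => 1) s l ω ∂μ = 0 := by
    have := h2.2.1
    rw [hm, hzero, mul_zero] at this
    exact this
  rw [covariance_eq_sub h1.1 h2.1]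
  change _ - _ * ∫ ω, simpleW x₀ X (fun _ _ => 1) s l ω ∂μ = 0
  rw [h3, mul_zero, sub_zero]
  -- In the product of the two estimates the common factors `i < k - 1` occur squared, and those
  -- with `k - 1 ≤ i < l - 1` occur once.
  let e : ℕ → ℝ → ℝ := fun i y => if i < k - 1 then y * y else y
  have he (i : ℕ) : Measurable (e i) := by
    by_cases hi : i < k - 1 <;> simp only [e, hi, if_true, if_false] <;> fun_prop
  have hind : iIndepFun (fun i ω => e i (X i ω / x₀ - 1)) μ :=
    h.iIndepFun_ratio.comp (fun i z => e i z.2) fun i => (he i).comp measurable_snd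
  have hprod (ω : Ω) : simpleW x₀ X (fun _ _ => 1) r k ω * simpleW x₀ X (fun _ _ => 1) s l ω =
      ∏ i ∈ Finset.range (l - 1), e i (X i ω / x₀ - 1) := by
    have hsub : (Finset.range (l - 1)).filter (· < k - 1) = Finset.range (k - 1) := by
      ext i
      simp only [Finset.mem_filter, Finset.mem_range]
      omega
    simp only [simpleW, one_mul]
    rw [← hsub, Finset.prod_filter, ← Finset.prod_mul_distrib]
    refine Finset.prod_congr rfl fun i _ => ?_
    simp only [e]
    split_ifs <;> ring
  have hint := (iIndepFun_integrable_prod_and_integral hind (fun i => (he i).comp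
    (((hX i).div_const x₀).sub_const 1)) (Finset.range (l - 1)) fun i _ => by
      by_cases hi : i < k - 1
      · simpa only [e, hi, if_true, ← sq] using (h.memLp_ratio i).integrable_sq
      · simpa only [e, hi, if_false] using (h.memLp_ratio i).integrable one_le_two).2
  change ∫ ω, simpleW x₀ X (fun _ _ => 1) r k ω * simpleW x₀ X (fun _ _ => 1) s l ω ∂μ = 0
  simp only [hprod]
  rw [hint]
  -- The last factor of the longer product is unpaired because `k < l`, and its mean is zero.
  refine Finset.prod_eq_zero (i := l - 2) (Finset.mem_range.2 (by omega)) ?_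
  have hi : ¬ l - 2 < k - 1 := by omega
  simp only [e, hi, if_false]
  rw [h.integral_ratio, hm]

/-- For unit gradient samples and expansion at the mean, the limit of the expected conditional
variance of the simple estimator is positive as soon as the second term of the series counts. -/
theorem GradientSetting.exists_tendsto_expCondVar_ne_zero
    (h : GradientSetting μ f x₀ m θ X (fun _ _ => 1) R) (hm : m θ / x₀ - 1 = 0)
    (hγ : taylorCoeff f x₀ 2 ≠ 0) (hb : betaSq μ x₀ (m θ) X ≠ 0) :
    ∃ L : ℝ, L ≠ 0 ∧ Tendsto
      (fun p : ℝ => expCondVar μ (R p) (gradSumEst μ f x₀ (R p) (simpleW x₀ X (fun _ _ => 1))))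
      (𝓝[>] 0) (𝓝 L) := by
  obtain ⟨hlim, hsum⟩ := h.tendsto_expCondVar_simpleW
  refine ⟨_, ne_of_gt ?_, hlim⟩
  have hdiag (k : ℕ) (hk : 1 ≤ k) : covariance (simpleW x₀ X (fun _ _ => 1) k k)
      (simpleW x₀ X (fun _ _ => 1) k k) μ = variance (simpleW x₀ X (fun _ _ => 1) k k) μ :=
    covariance_self (h.isPowerEstimate_simpleW.memLp k k hk le_rfl).aemeasurable
  have hnn (z : ℕ × ℕ) : 0 ≤ (z.1 * taylorCoeff f x₀ z.1 / x₀) *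
      (z.2 * taylorCoeff f x₀ z.2 / x₀) * covariance (simpleW x₀ X (fun _ _ => 1) z.1 z.1)
        (simpleW x₀ X (fun _ _ => 1) z.2 z.2) μ := by
    obtain ⟨k, l⟩ := z
    rcases Nat.eq_zero_or_pos k with rfl | hk
    · simp
    rcases Nat.eq_zero_or_pos l with rfl | hl
    · simp
    rcases lt_trichotomy k l with hkl | rfl | hkl
    · rw [h.covariance_simpleW_eq_zero_of_lt hm hk hkl, mul_zero]
    · rw [hdiag k hk]
      exact mul_nonneg (mul_self_nonneg _) (variance_nonneg _ _)
    · rw [covariance_comm, h.covariance_simpleW_eq_zero_of_lt hm hl hkl, mul_zero]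
  -- The estimate for `k = 1` is the constant `1`, so `k = 2` is the first index that can carry
  -- variance; its variance is `β²`.
  refine hsum.tsum_pos hnn (2, 2) ?_
  have h2 := h.memLp_and_integral_simpleW one_le_two 2
  have hv := variance_eq_sub h2.1
  have e1 : ∫ ω, simpleW x₀ X (fun _ _ => 1) 2 2 ω ∂μ = 0 := by
    have := h2.2.1
    rw [hm] at this
    simpa using this
  have e2 : ∫ ω, simpleW x₀ X (fun _ _ => 1) 2 2 ω ^ 2 ∂μ = betaSq μ x₀ (m θ) X := by
    have := h2.2.2
    simpa using this
  have e3 : variance (simpleW x₀ X (fun _ _ => 1) 2 2) μ = betaSq μ x₀ (m θ) X := by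
    rw [← e2, ← sub_zero (∫ ω, _ ∂μ), ← zero_pow two_ne_zero, ← e1]
    exact hv
  change 0 < ((2 : ℕ) * taylorCoeff f x₀ 2 / x₀) * ((2 : ℕ) * taylorCoeff f x₀ 2 / x₀) *
    covariance (simpleW x₀ X (fun _ _ => 1) 2 2) (simpleW x₀ X (fun _ _ => 1) 2 2) μ
  rw [hdiag 2 one_le_two, e3]
  refine mul_pos (mul_self_pos.2 (div_ne_zero (mul_ne_zero (by norm_num) hγ) h.x₀_ne_zero)) ?_
  exact lt_of_le_of_ne h.betaSq_nonneg hb.symm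

/-- The law of a Gaussian sequence with mean `1` and variance `1 / 4`, and of independent geometric
variables of every parameter. -/
noncomputable def gaussianGeometricMeasure : Measure ((ℕ → ℝ) × (ℝ → ℕ)) :=
  (Measure.infinitePi fun _ : ℕ => gaussianReal 1 (1 / 4)).prod
    (Measure.infinitePi fun p : ℝ => geometricMeasure (Set.projIcc 0 1 zero_le_one p))

instance : IsProbabilityMeasure gaussianGeometricMeasure := by
  unfold gaussianGeometricMeasure
  infer_instance

theorem hasLaw_gaussian_coordinate (i : ℕ) :
    HasLaw (fun ω : (ℕ → ℝ) × (ℝ → ℕ) => ω.1 i) (gaussianReal 1 (1 / 4))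
      gaussianGeometricMeasure :=
  ((measurePreserving_eval_infinitePi (fun _ : ℕ => gaussianReal 1 (1 / 4)) i).comp
    measurePreserving_fst).hasLaw

theorem hasLaw_geometric_coordinate (p : ℝ) :
    HasLaw (fun ω : (ℕ → ℝ) × (ℝ → ℕ) => ω.2 p)
      (geometricMeasure (Set.projIcc 0 1 zero_le_one p)) gaussianGeometricMeasure :=
  ((measurePreserving_eval_infinitePi
    (fun p : ℝ => geometricMeasure (Set.projIcc 0 1 zero_le_one p)) p).comp
    measurePreserving_snd).hasLaw

theorem betaSq_gaussianGeometricMeasure :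
    betaSq gaussianGeometricMeasure 1 1 (fun i ω => ω.1 i) = 1 / 4 := by
  rw [betaSq, (hasLaw_gaussian_coordinate 0).variance_eq, variance_id_gaussianReal]
  simp

theorem gradientSetting_gaussianGeometricMeasure :
    GradientSetting gaussianGeometricMeasure Real.log 1 id 1 (fun i ω => ω.1 i) (fun _ _ => 1)
      (fun p ω => ω.2 p) where
  x₀_ne_zero := one_ne_zero
  measurable_X i := by fun_prop
  measurable_G i := by fun_prop
  indep := by
    have hind : iIndepFun (fun (i : ℕ) (ω : (ℕ → ℝ) × (ℝ → ℕ)) => ω.1 i)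
        gaussianGeometricMeasure := by
      rw [iIndepFun_iff_map_fun_eq_infinitePi_map fun i => by fun_prop]
      simp only [(hasLaw_gaussian_coordinate _).map_eq]
      exact measurePreserving_fst.map_eq
    exact hind.comp (fun _ x => (x, (1 : ℝ))) fun _ => by fun_prop
  identDistrib i := by
    have : IdentDistrib (fun ω : (ℕ → ℝ) × (ℝ → ℕ) => ω.1 i)
        (fun ω : (ℕ → ℝ) × (ℝ → ℕ) => ω.1 0) gaussianGeometricMeasure gaussianGeometricMeasure :=
      ⟨by fun_prop, by fun_prop,
        by rw [(hasLaw_gaussian_coordinate i).map_eq, (hasLaw_gaussian_coordinate 0).map_eq]⟩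
    exact this.comp (u := fun x : ℝ => (x, (1 : ℝ))) (by fun_prop)
  memLp_X := by
    have h := memLp_id_gaussianReal' (μ := 1) (v := 1 / 4) 2 (by simp)
    rw [← (hasLaw_gaussian_coordinate 0).map_eq] at h
    exact h.comp_of_map (by fun_prop)
  memLp_G := memLp_const 1
  mean_X := (hasLaw_gaussian_coordinate 0).integral_eq.trans integral_id_gaussianReal
  mean_G := by
    rw [integral_const]
    simpa using hasDerivAt_id (1 : ℝ)
  taylor := taylorAssumption_log_one
  betaSq_lt_one := by
    rw [id, betaSq_gaussianGeometricMeasure]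
    norm_num
  measurable_R p _ _ := by fun_prop
  law_R p hp₀ hp₁ _ := by
    have h := hasLaw_geometric_coordinate p
    -- Clamping to the unit interval gives a law for every real `p`; for `0 < p ≤ 1` it changes
    -- nothing.
    rwa [Set.projIcc_of_mem zero_le_one ⟨hp₀.le, hp₁⟩] at h
  indep_R p _ _ :=
    (indepFun_prod (X := fun (x : ℕ → ℝ) (i : ℕ) => (x i, (1 : ℝ))) (Y := fun y : ℝ → ℕ => y p)
      (by fun_prop) (by fun_prop)).symm

end Example

theorem proposition4 :
    (∀ (Ω : Type*) [MeasurableSpace Ω] (μ : Measure Ω) [IsProbabilityMeasure μ]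
        (f : ℝ → ℝ) (x₀ : ℝ) (m : ℝ → ℝ) (θ : ℝ) (X G : ℕ → Ω → ℝ) (R : ℝ → Ω → ℕ),
      GradientSetting μ f x₀ m θ X G R →
      -- both estimators are square integrable
      (∀ p : ℝ, 0 < p → p < 1 - betaSq μ x₀ (m θ) X →
        MemLp (gradSumEst μ f x₀ (R p) (simpleW x₀ X G)) 2 μ ∧
        MemLp (gradSumEst μ f x₀ (R p) (cyclingW x₀ X G)) 2 μ) ∧
      -- variance of the conditional expectation, both estimators
      ((fun p : ℝ => varCondExp μ (R p) (gradSumEst μ f x₀ (R p) (simpleW x₀ X G)))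
          =O[𝓝[>] 0] (fun p : ℝ => p)) ∧
      ((fun p : ℝ => varCondExp μ (R p) (gradSumEst μ f x₀ (R p) (cyclingW x₀ X G)))
          =O[𝓝[>] 0] (fun p : ℝ => p)) ∧
      -- expected conditional variance of the simple estimator: finite limit
      (∃ L : ℝ, Tendsto
        (fun p : ℝ => expCondVar μ (R p) (gradSumEst μ f x₀ (R p) (simpleW x₀ X G)))
        (𝓝[>] 0) (𝓝 L)) ∧
      -- expected conditional variance of the cycling estimator
      ((fun p : ℝ => expCondVar μ (R p) (gradSumEst μ f x₀ (R p) (cyclingW x₀ X G)))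
          =O[𝓝[>] 0] (fun p : ℝ => p * Real.log (1 / p)))) ∧
    -- the limit for the simple estimator can be non-zero, already for the logarithm
    (∃ (Ω : Type) (_ : MeasurableSpace Ω) (μ : Measure Ω) (_ : IsProbabilityMeasure μ)
        (x₀ : ℝ) (m : ℝ → ℝ) (θ : ℝ) (X G : ℕ → Ω → ℝ) (R : ℝ → Ω → ℕ),
      0 < x₀ ∧ GradientSetting μ Real.log x₀ m θ X G R ∧
      ∃ L : ℝ, L ≠ 0 ∧ Tendsto
        (fun p : ℝ => expCondVar μ (R p) (gradSumEst μ Real.log x₀ (R p) (simpleW x₀ X G)))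
        (𝓝[>] 0) (𝓝 L)) := by
  refine ⟨?_, ?_⟩
  · intro Ω _ μ _ f x₀ m θ X G R h
    exact ⟨fun p hp₀ hp₁ => ⟨h.memLp_gradSumEst h.isPowerEstimate_simpleW hp₀ hp₁,
        h.memLp_gradSumEst h.isPowerEstimate_cyclingW hp₀ hp₁⟩,
      h.isBigO_varCondExp h.isPowerEstimate_simpleW,
      h.isBigO_varCondExp h.isPowerEstimate_cyclingW,
      ⟨_, h.tendsto_expCondVar_simpleW.1⟩, h.isBigO_expCondVar_cyclingW⟩
  · refine ⟨(ℕ → ℝ) × (ℝ → ℕ), inferInstance, gaussianGeometricMeasure, inferInstance, 1, id, 1,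
      fun i ω => ω.1 i, fun _ _ => 1, fun p ω => ω.2 p, one_pos,
      gradientSetting_gaussianGeometricMeasure, ?_⟩
    refine gradientSetting_gaussianGeometricMeasure.exists_tendsto_expCondVar_ne_zero (by simp)
      ?_ ?_
    · rw [taylorCoeff_log_one_succ 1]
      norm_num
    · rw [id, betaSq_gaussianGeometricMeasure]
      norm_num
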